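/- Let $D=(V,A)$ be a finite digraph (parallel arcs allowed), let $c:A\to\mathbb{R}$ be a cost function on the arcs, and let $k$ be a positive integer. A spanning arborescence of $D$ is an arc set $F\subseteq A$ that is a spanning tree of $V$ in the undirected sense and in which every node has in-degree at most one; its root is the unique node of in-degree zero. A $k$-arborescence is the union of $k$ pairwise arc-disjoint spanning arborescences, and its root vector is the vector $q\in\mathbb{Z}_{\ge 0}^V$ whose entry $q(v)$ is the number of these arborescences that are rooted at $v$ (it does not depend on the decomposition chosen). A $k$-arborescence $F$ is optimal if $c(F)=\sum_{a\in F}c(a)$ is minimum among all $k$-arborescences of $D$. Suppose that $D$ has at least one $k$-arborescence. Then the convex hull in $\mathbb{R}^V$ of the root vectors of the optimal $k$-arborescences of $D$ is a base polyhedron; that is, there is a set function $p:2^V\to\mathbb{R}$ with $p(\emptyset)=0$ that is supermodular, i.e. $p(X)+p(Y)\le p(X\cap Y)+p(X\cup Y)$ for all $X,Y\subseteq V$, such that this convex hull equals $$B(p)=\Big\{x\in\mathbb{R}^V:\ \sum_{v\in V}x(v)=p(V),\ \ \sum_{v\in Z}x(v)\ge p(Z)\ \text{ for all } Z\subseteq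 V\Big\}.$$ -/

import Mathlib

/-- A digraph with node set `V` and arc set `A`; parallel arcs (and loops) are allowed. -/
structure ArcDigraph (V A : Type*) where
  tail : A → V
  head : A → V

namespace ArcDigraph

variable {V A : Type*} [DecidableEq V] (D : ArcDigraph V A)

/-- The in-degree of the node `v` in the arc set `F`. -/
def inDegree (F : Finset A) (v : V) : ℕ :=
  (F.filter fun a => D.head a = v).card

/-- `F`, with orientations forgotten, is a spanning tree on `V`. Being a tree for an undirected
multigraph means: there are no loops, no two edges have the same pair of ends, and the resulting
simple graph is a tree. -/
structure IsSpanningTree (F : Finset A) : Prop where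
  loopless : ∀ a ∈ F, D.tail a ≠ D.head a
  noParallel : Set.InjOn (fun a => s(D.tail a, D.head a)) (F : Set A)
  isTree : (SimpleGraph.fromEdgeSet ((fun a => s(D.tail a, D.head a)) '' (F : Set A))).IsTree

/-- A spanning arborescence: a spanning tree in the undirected sense in which every node has
in-degree at most one. -/
structure IsArborescence (F : Finset A) : Prop where
  isSpanningTree : D.IsSpanningTree F
  inDegree_le_one : ∀ v, D.inDegree F v ≤ 1

/-- A spanning arborescence with root node `r`, the node of in-degree zero. -/
structure IsArborescenceRootedAt (F : Finset A) (r : V) : Prop where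
  isArborescence : D.IsArborescence F
  inDegree_root : D.inDegree F r = 0

/-- The sets `T 0, …, T (k - 1)` are pairwise disjoint spanning arborescences with union `F`. -/
structure IsDecomposition {k : ℕ} (F : Finset A) (T : Fin k → Finset A) : Prop where
  isArborescence : ∀ i, D.IsArborescence (T i)
  disjoint : ∀ i j, i ≠ j → Disjoint (T i) (T j)
  mem_iff : ∀ a, a ∈ F ↔ ∃ i, a ∈ T i

/-- A `k`-arborescence: an arc-disjoint union of `k` spanning arborescences. -/
def IsKArborescence (k : ℕ) (F : Finset A) : Prop :=
  ∃ T : Fin k → Finset A, D.IsDecomposition F T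

/-- `q` is the root vector of the `k`-arborescence `F`: for a decomposition of `F` into `k`
spanning arborescences with roots `r 0, …, r (k - 1)`, the entry `q v` is the number of those
rooted at `v`. -/
def IsRootVector (k : ℕ) (F : Finset A) (q : V → ℝ) : Prop :=
  ∃ (T : Fin k → Finset A) (r : Fin k → V),
    D.IsDecomposition F T ∧ (∀ i, D.IsArborescenceRootedAt (T i) (r i)) ∧
      ∀ v, q v = ((Finset.univ.filter fun i => r i = v).card : ℝ)

/-- A `k`-arborescence of minimum cost with respect to the arc costs `c`. -/
def IsOptimalKArborescence (k : ℕ) (c : A → ℝ) (F : Finset A) : Prop :=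
  D.IsKArborescence k F ∧
    ∀ F' : Finset A, D.IsKArborescence k F' → ∑ a ∈ F, c a ≤ ∑ a ∈ F', c a

/-- The set of root vectors of the minimum-cost `k`-arborescences. -/
def optimalRootVectors (k : ℕ) (c : A → ℝ) : Set (V → ℝ) :=
  {q | ∃ F : Finset A, D.IsOptimalKArborescence k c F ∧ D.IsRootVector k F q}

end ArcDigraph

/-- A (fully) supermodular set function. -/
def IsSupermodular {S : Type*} [DecidableEq S] (p : Finset S → ℝ) : Prop :=
  ∀ X Y : Finset S, p X + p Y ≤ p (X ∩ Y) + p (X ∪ Y)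

/-- The polyhedron `B(p) = {x : x(S) = p(S), x(Z) ≥ p(Z) for all Z ⊆ S}`. -/
def basePolyhedron {S : Type*} [Fintype S] (p : Finset S → ℝ) : Set (S → ℝ) :=
  {x | ∑ s, x s = p Finset.univ ∧ ∀ Z : Finset S, p Z ≤ ∑ s ∈ Z, x s}

/-- A base polyhedron: a set `B(p)` for a fully supermodular `p` with `p(∅) = 0`. -/
def IsBasePolyhedron {S : Type*} [Fintype S] [DecidableEq S] (B : Set (S → ℝ)) : Prop :=
  ∃ p : Finset S → ℝ, p ∅ = 0 ∧ IsSupermodular p ∧ B = basePolyhedron p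

/-! Call a set of integer vectors M-convex if it has constant coordinate sum and satisfies the
exchange axiom of `IsMConvex`. The proof shows that the root vectors of optimal `k`-arborescences
form a finite nonempty M-convex set, and that the hull of any such set is a base polyhedron
(`IsMConvex.isBasePolyhedron_convexHull`).

By a counting argument and Edmonds' disjoint arborescences theorem, `F` is a `k`-arborescence iff it
is a base of the matroid of sparse arc sets (at most `k(|X|-1)` arcs inside each nonempty `X`) and
all in-degrees are at most `k` (`ArcDigraph.isKArborescence_iff`). Its root vector is then `k` minus
the in-degree vector, that is, the slack in these degree bounds (`ArcDigraph.isRootVector_iff`).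

So the problem is to find cheapest bases of a matroid under capacity bounds on the classes of a
partition. The bounds are dualized: for optimal multipliers `π ≥ 0` (`exists_optimal_multipliers`),
the vectors sought are exactly the slack vectors of minimizers of the Lagrangian that are
nonnegative and vanish where `π > 0`. These minimizers are the minimum weight bases for the modified
cost `c a + π (head a)`. They have the base exchange property, which counting by heads turns into
M-convexity; nonnegativity and complementary slackness merely cut this set by a box, which preserves
M-convexity. -/

/-! ### M-convex sets: exchange, linear minimization, convex hull. -/

section MConvex

/-- The `ℓ¹` distance of two integer vectors. -/
def l1Dist {V : Type*} [Fintype V] (x y : V → ℤ) : ℕ := ∑ v, (x v - y v).natAbs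

theorem l1Dist_comm {V : Type*} [Fintype V] (x y : V → ℤ) : l1Dist x y = l1Dist y x := by
  unfold l1Dist
  exact Finset.sum_congr rfl fun v _ => by omega

variable {V : Type*} [DecidableEq V]

/-- The vector obtained from `x` by moving one unit from the coordinate `u` to `v`. -/
def moveUnit (x : V → ℤ) (u v : V) : V → ℤ :=
  fun w => x w - (if w = u then 1 else 0) + (if w = v then 1 else 0)

theorem neg_moveUnit (x : V → ℤ) (u v : V) : -moveUnit x u v = moveUnit (-x) v u := by
  funext w
  simp only [moveUnit, Pi.neg_apply]
  ring

theorem moveUnit_moveUnit (x : V → ℤ) (u v w : V) :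
    moveUnit (moveUnit x u v) v w = moveUnit x u w := by
  funext t
  simp only [moveUnit]
  ring

theorem sum_moveUnit (x : V → ℤ) (u v : V) (Z : Finset V) :
    ∑ w ∈ Z, moveUnit x u v w
      = ∑ w ∈ Z, x w - (if u ∈ Z then 1 else 0) + (if v ∈ Z then 1 else 0) := by
  simp [moveUnit, Finset.sum_add_distrib, Finset.sum_sub_distrib]

variable [Fintype V]

theorem l1Dist_moveUnit_lt {x y : V → ℤ} {u v : V} (hu : y u < x u) (hv : x v < y v) :
    l1Dist (moveUnit x u v) y < l1Dist x y := by
  unfold l1Dist moveUnit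
  refine Finset.sum_lt_sum (fun w _ => ?_) ⟨u, Finset.mem_univ u, ?_⟩
  · split_ifs with h1 h2 h2 <;> subst_vars <;> omega
  · have : u ≠ v := by rintro rfl; omega
    simp only [if_true, if_neg this]
    omega

/-- A set of integer vectors with constant coordinate sum satisfying the exchange axiom. -/
structure IsMConvex (X : Set (V → ℤ)) : Prop where
  exchange : ∀ x ∈ X, ∀ y ∈ X, ∀ u, y u < x u → ∃ v, x v < y v ∧ moveUnit x u v ∈ X
  sum_eq : ∀ x ∈ X, ∀ y ∈ X, ∑ v, x v = ∑ v, y v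

namespace IsMConvex

variable {X : Set (V → ℤ)}

/-- The exchange axiom in the opposite direction. -/
theorem exchange_rev (hX : IsMConvex X) {x : V → ℤ} (hx : x ∈ X) {u : V} {y : V → ℤ}
    (hy : y ∈ X) (hu : x u < y u) : ∃ v, y v < x v ∧ moveUnit x v u ∈ X := by
  induction hn : l1Dist y x using Nat.strong_induction_on generalizing y with
  | _ n ih =>
  subst hn
  -- Walk `y` towards `x` for as long as a step keeps `y u` strictly above `x u`.
  by_cases hw : ∃ w, x w < y w ∧ (w = u → x u + 1 < y u)
  · obtain ⟨w, hw, hwu⟩ := hw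
    obtain ⟨t, ht, hyt⟩ := hX.exchange y hy x hx w hw
    have htw : t ≠ w := by rintro rfl; omega
    have htu : t ≠ u := by rintro rfl; omega
    obtain ⟨v, hv, hv'⟩ := ih _ (l1Dist_moveUnit_lt hw ht) hyt (by
      simp only [moveUnit, if_neg htu.symm]
      split_ifs with h
      · have := hwu h.symm; omega
      · omega) rfl
    refine ⟨v, ?_, hv'⟩
    simp only [moveUnit] at hv
    split_ifs at hv with h1 h2 h2 <;> subst_vars <;> omega
  -- Now `u` is the only coordinate where `y` exceeds `x`, and by exactly one. One exchange brings
  -- `y` below `x` everywhere, hence onto `x` since the sums agree.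
  · push Not at hw
    obtain ⟨v, hv, hyv⟩ := hX.exchange y hy x hx u hu
    have hvu : v ≠ u := by rintro rfl; omega
    have hle : ∀ w ∈ Finset.univ, moveUnit y u v w ≤ x w := by
      intro w _
      simp only [moveUnit]
      by_cases hwu : w = u
      · subst hwu
        have := hw w hu
        simp only [if_true, if_neg hvu.symm]
        have := this.2
        omega
      · have : ¬ x w < y w := fun h => hwu (hw w h).1
        split_ifs with h1
        · subst h1; omega
        · omega
    have heq := (Finset.sum_eq_sum_iff_of_le hle).1 (hX.sum_eq _ hyv _ hx)
    refine ⟨v, hv, ?_⟩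
    have : moveUnit x v u = y := by
      funext w
      have := heq w (Finset.mem_univ w)
      simp only [moveUnit] at this ⊢
      omega
    rwa [this]

theorem neg (hX : IsMConvex X) : IsMConvex (-X) where
  exchange x hx y hy u hu := by
    rw [Set.mem_neg] at hx hy
    obtain ⟨v, hv, h⟩ := hX.exchange_rev hx (u := u) hy (by simpa using hu)
    refine ⟨v, by simpa using hv, ?_⟩
    rwa [Set.mem_neg, neg_moveUnit]
  sum_eq x hx y hy := by
    have := hX.sum_eq _ hx _ hy
    simpa [Finset.sum_neg_distrib] using this

/-- An exchange moves `x u` and `x v` towards `y u` and `y v`, so box constraints met by `x` and `y`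
survive. -/
theorem inter_pi (hX : IsMConvex X) {I : V → Set ℤ} (hI : ∀ v, (I v).OrdConnected) :
    IsMConvex {x ∈ X | ∀ v, x v ∈ I v} where
  exchange x hx y hy u hu := by
    obtain ⟨v, hv, h⟩ := hX.exchange x hx.1 y hy.1 u hu
    refine ⟨v, hv, h, fun w => ?_⟩
    have huv : u ≠ v := by rintro rfl; omega
    simp only [moveUnit]
    split_ifs with h1 h2 h2
    · exact absurd (h1.symm.trans h2) huv
    · subst h1
      exact (hI w).out (hy.2 w) (hx.2 w) ⟨by omega, by omega⟩
    · subst h2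
      exact (hI w).out (hx.2 w) (hy.2 w) ⟨by omega, by omega⟩
    · simpa using hx.2 w
  sum_eq x hx y hy := hX.sum_eq x hx.1 y hy.1

/-- A member minimizing a linear function also minimizes the sum over each upper level set. -/
theorem sum_level_le (hX : IsMConvex X) {w : V → ℝ} {x : V → ℤ} (hx : x ∈ X)
    (hmin : ∀ z ∈ X, ∑ v, w v * x v ≤ ∑ v, w v * z v) (t : ℝ) {y : V → ℤ} (hy : y ∈ X) :
    ∑ v with t ≤ w v, x v ≤ ∑ v with t ≤ w v, y v := by
  induction hn : l1Dist x y using Nat.strong_induction_on generalizing y with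
  | _ n ih =>
  subst hn
  by_contra! hlt
  obtain ⟨u, huZ, hu⟩ := Finset.exists_lt_of_sum_lt hlt
  obtain ⟨v, hv, hxv⟩ := hX.exchange x hx y hy u hu
  have hval : ∑ s, w s * (moveUnit x u v s : ℝ) = ∑ s, w s * x s - w u + w v := by
    simp [moveUnit, mul_add, mul_sub, Finset.sum_add_distrib, Finset.sum_sub_distrib]
  have hge := hmin _ hxv
  rw [hval] at hge
  -- Minimality of `x` keeps `v` in the level set. Moving `y` towards `x` by lowering `v` therefore
  -- cannot raise its level sum, and the induction closes.
  have huv : w u ≤ w v := by linarith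
  simp only [Finset.mem_filter, Finset.mem_univ, true_and] at huZ
  have hvZ : t ≤ w v := huZ.trans huv
  obtain ⟨s, hs, hys⟩ := hX.exchange y hy x hx v hv
  have := ih _ (by rw [l1Dist_comm x, l1Dist_comm x]; exact l1Dist_moveUnit_lt hv hs)
    hys rfl
  rw [sum_moveUnit, if_pos (by simpa using hvZ)] at this
  split_ifs at this <;> omega

/-- The coordinates to which a unit can be moved from `u` form a set whose sum is minimum. -/
theorem sum_movable_le (hX : IsMConvex X) {x : V → ℤ} (hx : x ∈ X) (u : V) {W : Finset V}
    (hW : ∀ v, v ∈ W ↔ v = u ∨ moveUnit x u v ∈ X) {y : V → ℤ} (hy : y ∈ X) :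
    ∑ v ∈ W, x v ≤ ∑ v ∈ W, y v := by
  induction hn : l1Dist y x using Nat.strong_induction_on generalizing y with
  | _ n ih =>
  subst hn
  by_contra! hlt
  obtain ⟨s, hsW, hs⟩ := Finset.exists_lt_of_sum_lt hlt
  obtain ⟨v, hv, hxv⟩ := hX.exchange x hx y hy s hs
  -- `W` is closed under moves available from `x`: comparing `x - e_s + e_v` with `x - e_u + e_s` at
  -- `u`, the exchange can only land on `s` and yields `x - e_u + e_v`.
  have hvW : v ∈ W := by
    rw [hW]
    rcases (hW s).1 hsW with rfl | hsX
    · exact Or.inr hxv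
    by_cases hvu : v = u
    · exact Or.inl hvu
    by_cases hsu : s = u
    · subst hsu; exact Or.inr hxv
    right
    have hvs : v ≠ s := by rintro rfl; omega
    obtain ⟨t, ht, h⟩ := hX.exchange _ hxv _ hsX u (by
      simp [moveUnit, Ne.symm hsu, Ne.symm hvu])
    have hts : t = s := by
      by_contra hts
      simp only [moveUnit, if_neg hts] at ht
      split_ifs at ht <;> omega
    subst hts
    have : moveUnit (moveUnit x t v) u t = moveUnit x u v := by
      funext w
      simp only [moveUnit]
      ring
    rwa [← this]
  obtain ⟨t, ht, hyt⟩ := hX.exchange y hy x hx v hv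
  have := ih _ (l1Dist_moveUnit_lt hv ht) hyt rfl
  rw [sum_moveUnit, if_pos hvW] at this
  split_ifs at this <;> omega

/-- The total violation of the constraints `0 ≤ x v` for `v ∈ U` and `x v ≤ 0` for `v ∈ P`. -/
def violation (U P : Finset V) (x : V → ℤ) : ℕ :=
  ∑ v, ((if v ∈ U then (-x v).toNat else 0) + (if v ∈ P then (x v).toNat else 0))

theorem violation_neg (U P : Finset V) (x : V → ℤ) : violation P U (-x) = violation U P x := by
  unfold violation
  exact Finset.sum_congr rfl fun v _ => by simp [add_comm]

/-- The certificate is the set of coordinates reachable from `u` by one move. Since no move lowers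
the violation, they lie in `P` with `0 ≤ x v`; so `x` has positive sum there, and by
`sum_movable_le` this sum is minimum. -/
theorem exists_sum_pos (hX : IsMConvex X) {U P : Finset V} {x : V → ℤ} (hx : x ∈ X)
    (hmin : ∀ y ∈ X, violation U P x ≤ violation U P y) {u : V} (hu : u ∈ P) (hxu : 0 < x u) :
    ∃ W ⊆ P, ∀ y ∈ X, 0 < ∑ v ∈ W, y v := by
  classical
  let W : Finset V := Finset.univ.filter fun v => v = u ∨ moveUnit x u v ∈ X
  have hW : ∀ v, v ∈ W ↔ v = u ∨ moveUnit x u v ∈ X := fun v => by simp [W]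
  have key : ∀ v ∈ W, v ∈ P ∧ 0 ≤ x v := by
    intro v hv
    by_cases hvu : v = u
    · subst hvu; exact ⟨hu, hxu.le⟩
    have hvX : moveUnit x u v ∈ X := ((hW v).1 hv).resolve_left hvu
    by_contra hcon
    refine (hmin _ hvX).not_gt ?_
    unfold violation
    refine Finset.sum_lt_sum (fun w _ => ?_) ⟨u, Finset.mem_univ u, ?_⟩
    · simp only [moveUnit]
      by_cases hwu : w = u
      · subst hwu
        simp only [if_neg (Ne.symm hvu), if_true, if_pos hu]
        split_ifs <;> omega
      · by_cases hwv : w = v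
        · subst hwv
          simp only [if_neg hwu, if_true]
          by_cases hwP : w ∈ P
          · have : ¬ 0 ≤ x w := fun h => hcon ⟨hwP, h⟩
            split_ifs <;> omega
          · simp only [if_neg hwP]
            split_ifs <;> omega
        · simp [hwu, hwv]
    · simp only [moveUnit, if_neg (Ne.symm hvu), if_true, if_pos hu]
      split_ifs <;> omega
  refine ⟨W, fun v hv => (key v hv).1, fun y hy => ?_⟩
  refine lt_of_lt_of_le ?_ (hX.sum_movable_le hx u hW hy)
  exact Finset.sum_pos' (fun v hv => (key v hv).2) ⟨u, (hW u).2 (Or.inl rfl), hxu⟩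

/-- Either some member satisfies the sign constraints, or a set of coordinates witnesses that
none does. -/
theorem exists_mem_or_exists_certificate (hX : IsMConvex X) (hne : X.Nonempty)
    (U P : Finset V) :
    (∃ x ∈ X, (∀ v ∈ U, 0 ≤ x v) ∧ ∀ v ∈ P, x v ≤ 0) ∨
      (∃ W ⊆ U, ∀ y ∈ X, ∑ v ∈ W, y v < 0) ∨ ∃ W ⊆ P, ∀ y ∈ X, 0 < ∑ v ∈ W, y v := by
  let x := Function.argminOn (violation U P) X hne
  have hx : x ∈ X := Function.argminOn_mem _ _ _
  have hmin : ∀ y ∈ X, violation U P x ≤ violation U P y := fun y hy =>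
    Function.argminOn_le _ _ hy
  by_cases hP : ∃ u ∈ P, 0 < x u
  · obtain ⟨u, hu, hxu⟩ := hP
    exact Or.inr (Or.inr (hX.exists_sum_pos hx hmin hu hxu))
  by_cases hU : ∃ u ∈ U, x u < 0
  · obtain ⟨u, hu, hxu⟩ := hU
    obtain ⟨W, hWU, hW⟩ := hX.neg.exists_sum_pos (U := P) (P := U) (x := -x) (by simpa using hx)
      (fun y hy => by
        have := hmin (-y) hy
        rwa [violation_neg, ← neg_neg y, violation_neg])
      hu (by simpa using hxu)
    refine Or.inr (Or.inl ⟨W, hWU, fun y hy => ?_⟩)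
    simpa [Finset.sum_neg_distrib] using hW (-y) (by simpa using hy)
  · push Not at hP hU
    exact Or.inl ⟨x, hx, hU, hP⟩

end IsMConvex

/-- A form of Abel's summation for nonnegative weights. -/
theorem sum_mul_nonneg_of_level_sums {V : Type*} (d : V → ℝ) (s : Finset V) (w : V → ℝ)
    (hw : ∀ v ∈ s, 0 ≤ w v) (hd : ∀ t > 0, 0 ≤ ∑ v ∈ s with t ≤ w v, d v) :
    0 ≤ ∑ v ∈ s, w v * d v := by
  classical
  induction hn : s.card generalizing s w with
  | zero => simp [Finset.card_eq_zero.1 hn]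
  | succ n ih =>
  obtain ⟨v₀, hv₀, hmin⟩ := s.exists_min_image w (Finset.card_pos.1 (by omega))
  -- Peel off the smallest weight: it multiplies a full level sum, and the reduced weights vanish at
  -- `v₀`.
  have hsplit : ∑ v ∈ s, w v * d v
      = w v₀ * ∑ v ∈ s, d v + ∑ v ∈ s.erase v₀, (w v - w v₀) * d v := by
    rw [Finset.mul_sum, ← Finset.add_sum_erase s _ hv₀, ← Finset.add_sum_erase s _ hv₀, add_assoc,
      ← Finset.sum_add_distrib]
    congr 1
    exact Finset.sum_congr rfl fun v _ => by ring
  rw [hsplit]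
  refine add_nonneg ?_ ?_
  · rcases (hw v₀ hv₀).eq_or_lt with h | h
    · simp [← h]
    · have := hd _ h
      rw [Finset.filter_true_of_mem hmin] at this
      positivity
  · refine ih _ (fun v => w v - w v₀)
      (fun v hv => sub_nonneg.2 (hmin v (Finset.mem_of_mem_erase hv))) (fun t ht => ?_)
      (by rw [Finset.card_erase_of_mem hv₀]; omega)
    convert hd (t + w v₀) (by linarith [hw v₀ hv₀]) using 2
    ext v
    simp only [Finset.mem_filter, Finset.mem_erase]
    constructor
    · rintro ⟨⟨-, h⟩, h'⟩
      exact ⟨h, by linarith⟩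
    · rintro ⟨h, h'⟩
      refine ⟨⟨?_, h⟩, by linarith⟩
      rintro rfl
      linarith

theorem convex_basePolyhedron {V : Type*} [Fintype V] (p : Finset V → ℝ) :
    Convex ℝ (basePolyhedron p) := by
  rintro x ⟨hx, hx'⟩ y ⟨hy, hy'⟩ a b ha hb hab
  refine ⟨?_, fun Z => ?_⟩
  · simp only [Pi.add_apply, Pi.smul_apply, smul_eq_mul, Finset.sum_add_distrib,
      ← Finset.mul_sum, hx, hy]
    rw [← add_mul, hab, one_mul]
  · simp only [Pi.add_apply, Pi.smul_apply, smul_eq_mul, Finset.sum_add_distrib, ← Finset.mul_sum]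
    calc p Z = a * p Z + b * p Z := by rw [← add_mul, hab, one_mul]
      _ ≤ _ := add_le_add (mul_le_mul_of_nonneg_left (hx' Z) ha)
        (mul_le_mul_of_nonneg_left (hy' Z) hb)

/-- The convex hull of a finite M-convex set is a base polyhedron. -/
theorem IsMConvex.isBasePolyhedron_convexHull {X : Set (V → ℤ)} (hX : IsMConvex X)
    (hne : X.Nonempty) (hfin : X.Finite) :
    IsBasePolyhedron (convexHull ℝ ((fun (x : V → ℤ) (v : V) => (x v : ℝ)) '' X)) := by
  have hex : ∀ Z : Finset V, ∃ x ∈ X, ∀ y ∈ X, ∑ v ∈ Z, x v ≤ ∑ v ∈ Z, y v := fun Z =>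
    Set.exists_min_image X (fun x => ∑ v ∈ Z, x v) hfin hne
  choose m hm hmin using hex
  have hlevel : ∀ w : V → ℝ, ∃ x ∈ X, (∀ z ∈ X, ∑ v, w v * x v ≤ ∑ v, w v * (z v : ℝ)) ∧
      ∀ t : ℝ, ∑ v with t ≤ w v, x v = ∑ v with t ≤ w v, m {v | t ≤ w v} v := fun w => by
    obtain ⟨x, hx, hxm⟩ := Set.exists_min_image X (fun x => ∑ v, w v * (x v : ℝ)) hfin hne
    exact ⟨x, hx, hxm, fun t => le_antisymm (hX.sum_level_le hx hxm t (hm _)) (hmin _ x hx)⟩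
  -- `p Z` is the minimum of the `Z`-sum over `X`.
  refine ⟨fun Z => ((∑ v ∈ Z, m Z v : ℤ) : ℝ), by simp, fun Y Z => ?_, ?_⟩
  -- The upper level sets of this weight at 2 and 1 are `Y ∩ Z` and `Y ∪ Z`, so its minimizer
  -- attains `p` at both simultaneously.
  · let w : V → ℝ := fun v => (if v ∈ Y then 1 else 0) + (if v ∈ Z then 1 else 0)
    obtain ⟨x, hx, -, hxl⟩ := hlevel w
    have hcap : (Finset.univ.filter fun v => (2 : ℝ) ≤ w v) = Y ∩ Z := by
      ext v
      by_cases h1 : v ∈ Y <;> by_cases h2 : v ∈ Z <;> norm_num [w, h1, h2]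
    have hcup : (Finset.univ.filter fun v => (1 : ℝ) ≤ w v) = Y ∪ Z := by
      ext v
      by_cases h1 : v ∈ Y <;> by_cases h2 : v ∈ Z <;> simp [w, h1, h2]
    have e1 := hxl 2
    have e2 := hxl 1
    rw [hcap] at e1
    rw [hcup] at e2
    beta_reduce
    rw [← e1, ← e2]
    have hsum := Finset.sum_union_inter (s₁ := Y) (s₂ := Z) (f := x)
    have := hmin Y x hx
    have := hmin Z x hx
    norm_cast
    omega
  · refine Set.Subset.antisymm (convexHull_min ?_ (convex_basePolyhedron _)) ?_
    · rintro _ ⟨x, hx, rfl⟩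
      refine ⟨?_, fun Z => ?_⟩
      · beta_reduce
        rw [← hX.sum_eq x hx _ (hm _)]
        push_cast
        rfl
      · beta_reduce
        exact_mod_cast hmin Z x hx
    · rintro y ⟨hy, hy'⟩
      beta_reduce at hy hy'
      by_contra hcon
      obtain ⟨f, u, hfy, hfX⟩ := geometric_hahn_banach_point_closed (convex_convexHull ℝ _)
        ((hfin.image _).isClosed_convexHull ℝ) hcon
      let w : V → ℝ := fun v => f (Pi.single v 1)
      have hf : ∀ z : V → ℝ, f z = ∑ v, w v * z v := fun z => by
        conv_lhs => rw [← Finset.univ_sum_single z]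
        rw [map_sum]
        refine Finset.sum_congr rfl fun v _ => ?_
        have : (Pi.single v (z v) : V → ℝ) = z v • Pi.single v 1 := by
          rw [← Pi.single_smul]; simp
        rw [this, map_smul, smul_eq_mul, mul_comm]
      obtain ⟨x, hx, -, hxl⟩ := hlevel w
      have hlt := hfy.trans (hfX _ (subset_convexHull ℝ _ ⟨x, hx, rfl⟩))
      rw [hf, hf] at hlt
      have hd0 : ∑ v, (y v - (x v : ℝ)) = 0 := by
        rw [Finset.sum_sub_distrib, hy, ← hX.sum_eq x hx _ (hm _)]
        push_cast
        ring
      -- Shifting the weights to be nonnegative is harmless because `y - x` has total sum zero. Abel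
      -- summation then gives `f x ≤ f y`, contradicting the separation.
      obtain ⟨b, hb⟩ : ∃ b, ∀ v, b ≤ w v := by
        obtain ⟨b, hb⟩ := (Set.finite_range w).bddBelow
        exact ⟨b, fun v => hb ⟨v, rfl⟩⟩
      have key := sum_mul_nonneg_of_level_sums (fun v => y v - (x v : ℝ)) Finset.univ
        (fun v => w v - b) (fun v _ => sub_nonneg.2 (hb v)) (fun t _ => by
          have h1 := hxl (t + b)
          have h2 := hy' {v | t + b ≤ w v}
          have h3 : (Finset.univ.filter fun v => t ≤ w v - b)
              = Finset.univ.filter fun v => t + b ≤ w v :=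
            Finset.filter_congr fun v _ => le_sub_iff_add_le
          rw [h3, Finset.sum_sub_distrib, sub_nonneg]
          rw [← h1] at h2
          exact_mod_cast h2)
      have : ∑ v, (w v - b) * (y v - (x v : ℝ))
          = ∑ v, w v * y v - ∑ v, w v * (x v : ℝ) - b * ∑ v, (y v - (x v : ℝ)) := by
        rw [Finset.mul_sum, ← Finset.sum_sub_distrib, ← Finset.sum_sub_distrib]
        exact Finset.sum_congr rfl fun v _ => by ring
      rw [this, hd0] at key
      linarith

end MConvex

/-! ### From base exchange to M-convexity of fibre counts. -/

section Aggregation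

variable {V A : Type*} [DecidableEq V]

/-- The residual capacity at `v` of the set `F` whose elements are assigned to nodes by `h`. -/
def slack (h : A → V) (b : V → ℤ) (F : Finset A) (v : V) : ℤ :=
  b v - ((F.filter fun a => h a = v).card : ℤ)

theorem card_filter_exchange [DecidableEq A] (h : A → V) {F : Finset A} {a e : A} (ha : a ∈ F)
    (he : e ∉ F) :
    (fun v => (((insert e (F.erase a)).filter fun a => h a = v).card : ℤ))
      = moveUnit (fun v => ((F.filter fun a => h a = v).card : ℤ)) (h a) (h e) := by
  funext v
  have key : ∀ G : Finset A, ((G.filter fun a => h a = v).card : ℤ)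
      = ∑ x ∈ G, if h x = v then 1 else 0 := fun G => by
    simp
  have he' : e ∉ F.erase a := fun h => he (Finset.mem_of_mem_erase h)
  simp only [moveUnit, key]
  rw [Finset.sum_insert he', ← Finset.add_sum_erase F _ ha]
  simp only [eq_comm (a := v)]
  ring

variable [Fintype V]

/-- The aggregation along `h` of a family with the base exchange property is M-convex. -/
theorem isMConvex_image_card_filter [DecidableEq A] (h : A → V) {𝓑 : Set (Finset A)} {n : ℕ}
    (hcard : ∀ F ∈ 𝓑, F.card = n)
    (hex : ∀ F ∈ 𝓑, ∀ G ∈ 𝓑, ∀ a ∈ F, a ∉ G → ∃ e ∈ G, e ∉ F ∧ insert e (F.erase a) ∈ 𝓑) :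
    IsMConvex ((fun F v => ((F.filter fun a => h a = v).card : ℤ)) '' 𝓑) where
  exchange := by
    rintro _ ⟨F₀, hF₀, rfl⟩ _ ⟨G, hG, rfl⟩ u hu
    beta_reduce at hu
    generalize hx : (fun v => ((F₀.filter fun a => h a = v).card : ℤ)) = x
    have hxu : ((F₀.filter fun a => h a = u).card : ℤ) = x u := by rw [← hx]
    rw [hxu] at hu
    beta_reduce
    -- One base exchange may land in a class that is not deficient. Then `F` has more elements than
    -- `G` in that class, so another exchange can start there; the net effect remains one unit moved
    -- out of `u`, while `F \ G` shrinks.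
    have walk : ∀ (m : ℕ) (F : Finset A) (w : V), F ∈ 𝓑 →
        (fun v => ((F.filter fun a => h a = v).card : ℤ)) = moveUnit x u w →
        (F \ G).card = m →
        ∃ v, x v < ((G.filter fun a => h a = v).card : ℤ) ∧
          moveUnit x u v ∈ (fun F v => ((F.filter fun a => h a = v).card : ℤ)) '' 𝓑 := by
      intro m
      induction m using Nat.strong_induction_on with
      | _ m ih =>
      intro F w hF hFx hm
      by_cases hw : x w < ((G.filter fun a => h a = w).card : ℤ)
      · exact ⟨w, hw, F, hF, hFx⟩
      have hgt : (G.filter fun a => h a = w).card < (F.filter fun a => h a = w).card := by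
        have := congrFun hFx w
        simp only [moveUnit, if_true] at this
        split_ifs at this with hwu
        · subst hwu; omega
        · omega
      obtain ⟨a, haF, haG⟩ := Finset.exists_mem_notMem_of_card_lt_card hgt
      rw [Finset.mem_filter] at haF haG
      obtain ⟨haF, haw⟩ := haF
      have haG : a ∉ G := fun h => haG ⟨h, haw⟩
      obtain ⟨e, heG, heF, he⟩ := hex F hF G hG a haF haG
      refine ih _ ?_ (insert e (F.erase a)) (h e) he ?_ rfl
      · rw [← hm]
        refine Finset.card_lt_card ⟨fun s hs => ?_, fun hs => ?_⟩
        · simp only [Finset.mem_sdiff, Finset.mem_insert, Finset.mem_erase] at hs ⊢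
          rcases hs with ⟨rfl | hs, hsG⟩
          · exact absurd heG hsG
          · exact ⟨hs.2, hsG⟩
        · have := hs (Finset.mem_sdiff.2 ⟨haF, haG⟩)
          simp only [Finset.mem_sdiff, Finset.mem_insert, Finset.mem_erase] at this
          rcases this with ⟨rfl | hs, -⟩
          · exact heF haF
          · exact hs.1 rfl
      · rw [card_filter_exchange h haF heF, hFx, haw, moveUnit_moveUnit]
    have hstart : x = moveUnit x u u := by
      funext v
      simp [moveUnit]
    have := walk _ F₀ u hF₀ (hx.trans hstart) rfl
    subst hx
    exact this
  sum_eq := by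
    have key : ∀ F ∈ 𝓑, ∑ v, ((F.filter fun a => h a = v).card : ℤ) = n := fun F hF => by
      rw [← hcard F hF, Finset.card_eq_sum_card_fiberwise (f := h) (t := Finset.univ)
        (fun _ _ => Finset.mem_coe.2 (Finset.mem_univ _))]
      push_cast
      rfl
    rintro _ ⟨F, hF, rfl⟩ _ ⟨G, hG, rfl⟩
    exact (key F hF).trans (key G hG).symm

theorem IsMConvex.image_const_sub {X : Set (V → ℤ)} (hX : IsMConvex X) (b : V → ℤ) :
    IsMConvex ((fun x => b - x) '' X) where
  exchange := by
    rintro _ ⟨x, hx, rfl⟩ _ ⟨y, hy, rfl⟩ u hu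
    obtain ⟨v, hv, h⟩ := hX.exchange_rev hx (u := u) hy (by simp at hu; omega)
    refine ⟨v, by simp; omega, _, h, ?_⟩
    funext w
    simp only [moveUnit, Pi.sub_apply]
    ring
  sum_eq := by
    rintro _ ⟨x, hx, rfl⟩ _ ⟨y, hy, rfl⟩
    simp [Finset.sum_sub_distrib, hX.sum_eq x hx y hy]

end Aggregation

/-! ### Exchange between minimum weight bases. -/

section Matroid

variable {A : Type*}

/-- The minimum weight bases of a matroid have the base exchange property. -/
theorem Matroid.minWeight_exchange [DecidableEq A] (M : Matroid A) (hE : M.E = Set.univ)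
    (w : A → ℝ)     {F G : Finset A} (hF : M.IsBase F)
    (hFmin : ∀ H : Finset A, M.IsBase H → ∑ a ∈ F, w a ≤ ∑ a ∈ H, w a)
    (hG : M.IsBase G) (hGmin : ∀ H : Finset A, M.IsBase H → ∑ a ∈ G, w a ≤ ∑ a ∈ H, w a)
    {a : A} (haF : a ∈ F) (haG : a ∉ G) :
    ∃ e ∈ G, e ∉ F ∧ M.IsBase (insert e (F.erase a) : Finset A) ∧
      ∀ H : Finset A, M.IsBase H → ∑ x ∈ insert e (F.erase a), w x ≤ ∑ x ∈ H, w x := by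
  have haG' : a ∉ (G : Set A) := by simpa using haG
  have haE : a ∈ M.E := by simp [hE]
  have hcl : a ∈ M.closure (G : Set A) := by rwa [hG.closure_eq]
  have hC := hG.fundCircuit_isCircuit haE haG'
  have hacl : a ∉ M.closure ((F : Set A) \ {a}) :=
    hF.indep.notMem_closure_sdiff_of_mem (by simpa using haF)
  -- Symmetric exchange: some `e` in the fundamental circuit of `a` over `G` escapes the closure of
  -- `F \ {a}`, so both `F - a + e` and `G - e + a` are bases. Optimality of `G` gives `w e ≤ w a`.
  obtain ⟨e, ⟨heC, hea⟩, hecl⟩ :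
      ∃ e ∈ M.fundCircuit a G \ {a}, e ∉ M.closure ((F : Set A) \ {a}) := by
    by_contra! hcon
    refine hacl ?_
    have h1 := hC.mem_closure_sdiff_singleton_of_mem (M.mem_fundCircuit a G)
    exact M.closure_subset_closure_of_subset_closure hcon h1
  have heG : e ∈ G := by
    have := M.fundCircuit_subset_insert a G heC
    rcases this with h | h
    · exact absurd h hea
    · simpa using h
  have heF : e ∉ F := fun h => hecl (M.mem_closure_of_mem' ⟨by simpa using h, hea⟩ (by simp [hE]))
  have hb1 : M.IsBase (insert e (F.erase a) : Finset A) := by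
    have := hF.exchange_base_of_notMem_closure (by simpa using haF) hecl (by simp [hE])
    simpa using this
  have hb2 : M.IsBase (insert a (G.erase e) : Finset A) := by
    have h1 := (hG.indep.mem_fundCircuit_iff hcl haG').1 heC
    have h2 := hG.exchange_isBase_of_indep' (by simpa using heG) haG' h1
    have h3 : (insert a (G.erase e) : Finset A) = ((insert a (G : Set A)) \ {e} : Set A) := by
      ext s
      simp only [Finset.coe_insert, Finset.coe_erase, Set.mem_insert_iff, Set.mem_sdiff,
        Finset.mem_coe, Set.mem_singleton_iff]
      constructor
      · rintro (rfl | h)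
        · exact ⟨Or.inl rfl, fun h => haG (h ▸ heG)⟩
        · exact ⟨Or.inr h.1, h.2⟩
      · rintro ⟨rfl | h, h'⟩
        · exact Or.inl rfl
        · exact Or.inr ⟨h, h'⟩
    rwa [h3]
  refine ⟨e, heG, heF, hb1, fun H hH => ?_⟩
  have h1 := hGmin _ hb2
  have e1 : e ∉ F.erase a := fun h => heF (Finset.mem_of_mem_erase h)
  have e2 : a ∉ G.erase e := fun h => haG (Finset.mem_of_mem_erase h)
  rw [Finset.sum_insert e2, ← Finset.add_sum_erase G _ heG] at h1
  have h2 := hFmin H hH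
  rw [← Finset.add_sum_erase F _ haF] at h2
  rw [Finset.sum_insert e1]
  linarith

end Matroid

/-! ### Lagrangian duality for capacitated bases. -/

section Lagrangian

open Filter Topology

variable {V A : Type*} [DecidableEq V] [Fintype V]

/-- The Lagrangian of the cost `c` for the capacity constraints with multipliers `π`. -/
def lagrangian (h : A → V) (b : V → ℤ) (c : A → ℝ) (π : V → ℝ) (F : Finset A) : ℝ :=
  ∑ a ∈ F, c a - ∑ v, π v * (slack h b F v : ℝ)

/-- The Lagrangian is, up to a constant independent of `F`, a linear weight on arcs, so its
minimizers over bases are minimum weight bases. -/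
theorem sum_add_multiplier (h : A → V) (b : V → ℤ) (c : A → ℝ) (π : V → ℝ) (F : Finset A) :
    ∑ a ∈ F, (c a + π (h a)) = lagrangian h b c π F + ∑ v, π v * (b v : ℝ) := by
  have h1 : ∑ a ∈ F, π (h a) = ∑ v, π v * ((F.filter fun a => h a = v).card : ℝ) := by
    rw [← Finset.sum_fiberwise F h]
    refine Finset.sum_congr rfl fun v _ => ?_
    rw [Finset.sum_congr rfl (g := fun _ => π v)
      (fun a ha => by rw [(Finset.mem_filter.1 ha).2]), Finset.sum_const, nsmul_eq_mul, mul_comm]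
  rw [Finset.sum_add_distrib, h1, lagrangian, sub_add, ← Finset.sum_sub_distrib,
    sub_eq_add_neg, ← Finset.sum_neg_distrib]
  congr 1
  refine Finset.sum_congr rfl fun v _ => ?_
  simp only [slack]
  push_cast
  ring

/-- The bases minimizing the Lagrangian. -/
def lagrangianMinimizers (M : Matroid A) (h : A → V) (b : V → ℤ) (c : A → ℝ) (π : V → ℝ) :
    Set (Finset A) :=
  {F | M.IsBase (F : Set A) ∧
    ∀ G : Finset A, M.IsBase (G : Set A) → lagrangian h b c π F ≤ lagrangian h b c π G}

theorem isMConvex_slack_lagrangianMinimizers (M : Matroid A) (hE : M.E = Set.univ) (h : A → V)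
    (b : V → ℤ) (c : A → ℝ) (π : V → ℝ) :
    IsMConvex (slack h b '' lagrangianMinimizers M h b c π) := by
  classical
  set 𝓑 := lagrangianMinimizers M h b c π with h𝓑
  have hmin : ∀ F ∈ 𝓑, ∀ H : Finset A, M.IsBase (H : Set A) →
      ∑ a ∈ F, (c a + π (h a)) ≤ ∑ a ∈ H, (c a + π (h a)) := fun F hF H hH => by
    rw [sum_add_multiplier h b, sum_add_multiplier h b]
    linarith [hF.2 H hH]
  rcases 𝓑.eq_empty_or_nonempty with h0 | ⟨F₀, hF₀⟩
  · rw [h0, Set.image_empty]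
    exact ⟨by simp, by simp⟩
  have key := (isMConvex_image_card_filter h (𝓑 := 𝓑) (n := F₀.card)
    (fun F hF => by
      have := hF.1.encard_eq_encard_of_isBase hF₀.1
      rwa [Set.encard_coe_eq_coe_finsetCard, Set.encard_coe_eq_coe_finsetCard, Nat.cast_inj] at this)
    (fun F hF G hG a haF haG => by
      obtain ⟨e, heG, heF, hb, hbm⟩ := M.minWeight_exchange hE (fun a => c a + π (h a)) hF.1
        (hmin F hF) hG.1 (hmin G hG) haF haG
      refine ⟨e, heG, heF, hb, fun H hH => ?_⟩
      have := hbm H hH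
      rw [sum_add_multiplier h b, sum_add_multiplier h b] at this
      linarith)).image_const_sub b
  rw [Set.image_image] at key
  exact key

variable [Fintype A]

theorem lagrangianMinimizers_nonempty (M : Matroid A) (h : A → V) (b : V → ℤ) (c : A → ℝ)
    (π : V → ℝ) : (lagrangianMinimizers M h b c π).Nonempty := by
  classical
  obtain ⟨B, hB⟩ := M.exists_isBase
  obtain ⟨F, hF, hmin⟩ := Set.exists_min_image {F : Finset A | M.IsBase (F : Set A)}
    (lagrangian h b c π) (Set.toFinite _) ⟨B.toFinite.toFinset, by simpa using hB⟩
  exact ⟨F, hF, hmin⟩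

/-- At a maximizer of the dual function over `K`, no feasible direction increases the
Lagrangian of all its minimizers. -/
theorem exists_lagrangianMinimizer_nonneg (M : Matroid A) (h : A → V) (b : V → ℤ) (c : A → ℝ)
    {K : Set (V → ℝ)} {π : V → ℝ}
    (hmax : ∀ π' ∈ K, ∃ G : Finset A, M.IsBase (G : Set A) ∧
      ∀ F : Finset A, M.IsBase (F : Set A) → lagrangian h b c π' G ≤ lagrangian h b c π F)
    (d : V → ℝ) (hdK : ∀ᶠ ε : ℝ in 𝓝[>] 0, π + ε • d ∈ K) :
    ∃ F ∈ lagrangianMinimizers M h b c π, 0 ≤ ∑ v, d v * (slack h b F v : ℝ) := by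
  by_contra! hcon
  obtain ⟨F₀, hF₀⟩ := lagrangianMinimizers_nonempty M h b c π
  have hlag : ∀ (ε : ℝ) (F : Finset A), lagrangian h b c (π + ε • d) F
      = lagrangian h b c π F - ε * ∑ v, d v * (slack h b F v : ℝ) := fun ε F => by
    simp only [lagrangian, Pi.add_apply, Pi.smul_apply, smul_eq_mul, add_mul,
      Finset.sum_add_distrib, Finset.mul_sum, mul_assoc]
    ring
  -- If `d` paired negatively with every minimizer's slack, a small step along `d` would raise all
  -- minimizers, while by continuity the other bases stay above the old minimum. The dual value
  -- would then increase.
  have hev : ∀ F : Finset A, ∀ᶠ ε : ℝ in 𝓝[>] 0, M.IsBase (F : Set A) →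
      lagrangian h b c π F₀ < lagrangian h b c (π + ε • d) F := by
    intro F
    by_cases hF : F ∈ lagrangianMinimizers M h b c π
    · filter_upwards [self_mem_nhdsWithin] with ε hε _
      have h1 := hF₀.2 F hF.1
      have h2 := mul_neg_of_pos_of_neg (Set.mem_Ioi.1 hε) (hcon F hF)
      rw [hlag]
      linarith
    · by_cases hFB : M.IsBase (F : Set A)
      · have hlt : lagrangian h b c π F₀ < lagrangian h b c π F := by
          by_contra! hle
          exact hF ⟨hFB, fun G hG => hle.trans (hF₀.2 G hG)⟩
        have hcont : Tendsto (fun ε : ℝ => lagrangian h b c (π + ε • d) F) (𝓝[>] 0)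
            (𝓝 (lagrangian h b c π F)) := by
          have : Continuous fun ε : ℝ => lagrangian h b c (π + ε • d) F := by
            simp only [hlag]
            fun_prop
          have h0 := this.tendsto 0
          simp only [zero_smul, add_zero] at h0
          exact h0.mono_left nhdsWithin_le_nhds
        filter_upwards [hcont.eventually_const_lt hlt] with ε hε _ using hε
      · exact Eventually.of_forall fun ε hb => absurd hb hFB
  obtain ⟨ε, hε, hK⟩ := ((eventually_all.2 hev).and hdK).exists
  obtain ⟨G, hG, hGle⟩ := hmax _ hK
  exact (hε G hG).not_ge (hGle F₀ hF₀.1)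

theorem exists_dual_maximizer (M : Matroid A) (h : A → V) (b : V → ℤ) (c : A → ℝ)
    {K : Set (V → ℝ)} (hK : IsCompact K) (hne : K.Nonempty) :
    ∃ π ∈ K, ∀ π' ∈ K, ∃ G : Finset A, M.IsBase (G : Set A) ∧
      ∀ F : Finset A, M.IsBase (F : Set A) → lagrangian h b c π' G ≤ lagrangian h b c π F := by
  classical
  let 𝓑 : Finset (Finset A) := Finset.univ.filter fun F => M.IsBase (F : Set A)
  have h𝓑 : ∀ F, F ∈ 𝓑 ↔ M.IsBase (F : Set A) := fun F => by simp [𝓑]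
  have h𝓑ne : 𝓑.Nonempty := by
    obtain ⟨F, hF⟩ := lagrangianMinimizers_nonempty M h b c 0
    exact ⟨F, (h𝓑 F).2 hF.1⟩
  have hcont : Continuous fun π => 𝓑.inf' h𝓑ne fun F => lagrangian h b c π F :=
    Continuous.finset_inf'_apply h𝓑ne fun F _ => by
      unfold lagrangian
      fun_prop
  obtain ⟨π, hπ, hmax⟩ := hK.exists_isMaxOn hne hcont.continuousOn
  refine ⟨π, hπ, fun π' hπ' => ?_⟩
  obtain ⟨G, hG, hGeq⟩ := Finset.exists_mem_eq_inf' h𝓑ne fun F => lagrangian h b c π' F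
  refine ⟨G, (h𝓑 G).1 hG, fun F hF => ?_⟩
  rw [← hGeq]
  exact (hmax hπ').trans (Finset.inf'_le _ ((h𝓑 F).2 hF))

/-- Optimal multipliers: some minimizer of the Lagrangian is feasible and satisfies
complementary slackness. -/
theorem exists_optimal_multipliers (M : Matroid A) (hE : M.E = Set.univ) (h : A → V) (b : V → ℤ)
    (c : A → ℝ) (hfeas : ∃ F : Finset A, M.IsBase (F : Set A) ∧ ∀ v, 0 ≤ slack h b F v) :
    ∃ π : V → ℝ, (∀ v, 0 ≤ π v) ∧ ∃ F ∈ lagrangianMinimizers M h b c π,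
      (∀ v, 0 ≤ slack h b F v) ∧ ∀ v, 0 < π v → slack h b F v = 0 := by
  obtain ⟨F₀, hF₀, hF₀s⟩ := hfeas
  -- The box bound makes the multipliers range over a compact set. It exceeds any cost difference
  -- between two arc sets, so one unit of overload at multiplier `R` is never worthwhile.
  let R : ℝ := 2 * ∑ a, |c a| + 1
  have hcF : ∀ F : Finset A, |∑ a ∈ F, c a| ≤ ∑ a, |c a| := fun F =>
    (Finset.abs_sum_le_sum_abs _ _).trans
      (Finset.sum_le_univ_sum_of_nonneg fun a => abs_nonneg _)
  have hR : 0 < R := by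
    have : 0 ≤ ∑ a, |c a| := Finset.sum_nonneg fun a _ => abs_nonneg _
    simp only [R]
    linarith
  obtain ⟨π, ⟨hπ0, hπR⟩, hmax⟩ := exists_dual_maximizer M h b c
    (K := Set.Icc (0 : V → ℝ) fun _ => R) isCompact_Icc ⟨0, le_rfl, fun _ => hR.le⟩
  -- `U` and `P` are the coordinates where `π` can still be raised or lowered. A certificate `W`
  -- from M-convexity would make raising or lowering `π` on `W` contradict dual optimality.
  let U : Finset V := Finset.univ.filter fun v => π v < R
  let P : Finset V := Finset.univ.filter fun v => 0 < π v
  have hdir : ∀ (W : Finset V) (s : ℝ), (∀ v ∈ W, ∀ᶠ ε : ℝ in 𝓝[>] 0, π v + ε * s ∈ Set.Icc 0 R) →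
      ∃ F ∈ lagrangianMinimizers M h b c π, 0 ≤ s * ((∑ v ∈ W, slack h b F v : ℤ) : ℝ) := by
    intro W s hW
    obtain ⟨F, hF, hFs⟩ := exists_lagrangianMinimizer_nonneg M h b c hmax
      (fun v => if v ∈ W then s else 0) (by
        have : ∀ v, ∀ᶠ ε : ℝ in 𝓝[>] 0, π v + ε * (if v ∈ W then s else 0) ∈ Set.Icc 0 R := by
          intro v
          by_cases hv : v ∈ W
          · simpa [hv] using hW v hv
          · simp only [hv, if_false, mul_zero, add_zero]
            exact Eventually.of_forall fun _ => ⟨hπ0 v, hπR v⟩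
        filter_upwards [eventually_all.2 this] with ε hε
        exact ⟨fun v => (hε v).1, fun v => (hε v).2⟩)
    refine ⟨F, hF, ?_⟩
    rw [Finset.sum_congr rfl (g := fun v => if v ∈ W then s * (slack h b F v : ℝ) else 0)
      (fun v _ => by split_ifs <;> simp)] at hFs
    rw [Finset.sum_ite_mem, Finset.univ_inter, ← Finset.mul_sum] at hFs
    exact_mod_cast hFs
  have htend : ∀ (v : V) (s : ℝ), Tendsto (fun ε : ℝ => π v + ε * s) (𝓝[>] 0) (𝓝 (π v)) := by
    intro v s
    have h0 : Continuous fun ε : ℝ => π v + ε * s := by fun_prop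
    have h1 := h0.tendsto 0
    simp only [zero_mul, add_zero] at h1
    exact h1.mono_left nhdsWithin_le_nhds
  obtain ⟨_, ⟨F, hF, rfl⟩, hFU, hFP⟩ :
      ∃ x ∈ slack h b '' lagrangianMinimizers M h b c π,
        (∀ v ∈ U, 0 ≤ x v) ∧ ∀ v ∈ P, x v ≤ 0 := by
    rcases (isMConvex_slack_lagrangianMinimizers M hE h b c π).exists_mem_or_exists_certificate
      ((lagrangianMinimizers_nonempty M h b c π).image _) U P with h1 | ⟨W, hWU, hW⟩ | ⟨W, hWP, hW⟩
    · exact h1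
    · exfalso
      obtain ⟨F, hF, hFs⟩ := hdir W 1 fun v hv => by
        have hv' : π v < R := (Finset.mem_filter.1 (hWU hv)).2
        filter_upwards [self_mem_nhdsWithin, (htend v 1).eventually_lt_const hv'] with ε h1 h2
        have := hπ0 v
        simp only [Set.mem_Ioi, Pi.zero_apply] at h1 this
        exact ⟨by linarith, h2.le⟩
      have := hW _ ⟨F, hF, rfl⟩
      have h2 : ((∑ v ∈ W, slack h b F v : ℤ) : ℝ) < 0 := by exact_mod_cast this
      linarith
    · exfalso
      obtain ⟨F, hF, hFs⟩ := hdir W (-1) fun v hv => by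
        have hv' : 0 < π v := (Finset.mem_filter.1 (hWP hv)).2
        filter_upwards [self_mem_nhdsWithin, (htend v (-1)).eventually_const_lt hv'] with ε h1 h2
        have := hπR v
        simp only [Set.mem_Ioi] at h1 this
        exact ⟨h2.le, by linarith⟩
      have := hW _ ⟨F, hF, rfl⟩
      have h2 : 0 < ((∑ v ∈ W, slack h b F v : ℤ) : ℝ) := by exact_mod_cast this
      linarith
  have hterm : ∀ v, π v * (slack h b F v : ℝ) ≤ 0 := by
    intro v
    rcases (hπ0 v).eq_or_lt with h0 | h0
    · simp [← h0]
    · have : (slack h b F v : ℝ) ≤ 0 := by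
        exact_mod_cast hFP v (Finset.mem_filter.2 ⟨Finset.mem_univ v, h0⟩)
      exact mul_nonpos_of_nonneg_of_nonpos (hπ0 v) this
  have hnonneg : ∀ v, 0 ≤ slack h b F v := by
    -- Negative slack can only occur where `π v = R`; the penalty then pushes the Lagrangian of `F`
    -- above that of the feasible `F₀`.
    by_contra! hneg
    obtain ⟨v, hv⟩ := hneg
    have hvR : π v = R := by
      by_contra hne
      exact absurd (hFU v (Finset.mem_filter.2
        ⟨Finset.mem_univ v, lt_of_le_of_ne (hπR v) hne⟩)) (not_le.2 hv)
    have h1 : ∑ v, π v * (slack h b F v : ℝ) ≤ -R := by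
      rw [← Finset.add_sum_erase _ _ (Finset.mem_univ v), hvR]
      have h6 : (slack h b F v : ℝ) ≤ -1 := by exact_mod_cast Int.le_sub_one_of_lt hv
      have h7 := Finset.sum_nonpos fun w (_ : w ∈ Finset.univ.erase v) => hterm w
      nlinarith
    have h2 := hF.2 F₀ hF₀
    have h3 : 0 ≤ ∑ v, π v * (slack h b F₀ v : ℝ) :=
      Finset.sum_nonneg fun w _ => mul_nonneg (hπ0 w) (by exact_mod_cast hF₀s w)
    unfold lagrangian at h2
    have h4 := (abs_le.1 (hcF F)).1
    have h5 := (abs_le.1 (hcF F₀)).2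
    simp only [R] at h1
    linarith
  refine ⟨π, hπ0, F, hF, hnonneg, fun v hv => le_antisymm (hFP v ?_) (hnonneg v)⟩
  exact Finset.mem_filter.2 ⟨Finset.mem_univ v, hv⟩

/-- The residual capacity vectors of the cheapest bases respecting the capacities form an
M-convex set. -/
theorem isMConvex_slack_optimal (M : Matroid A) (hE : M.E = Set.univ) (h : A → V) (b : V → ℤ)
    (c : A → ℝ) (hfeas : ∃ F : Finset A, M.IsBase (F : Set A) ∧ ∀ v, 0 ≤ slack h b F v) :
    IsMConvex (slack h b '' {F : Finset A | (M.IsBase (F : Set A) ∧ ∀ v, 0 ≤ slack h b F v) ∧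
      ∀ G : Finset A, M.IsBase (G : Set A) → (∀ v, 0 ≤ slack h b G v) →
        ∑ a ∈ F, c a ≤ ∑ a ∈ G, c a}) := by
  obtain ⟨π, hπ0, F₀, hF₀, hF₀s, hF₀π⟩ := exists_optimal_multipliers M hE h b c hfeas
  have hF₀lag : lagrangian h b c π F₀ = ∑ a ∈ F₀, c a := by
    rw [lagrangian, sub_eq_self]
    refine Finset.sum_eq_zero fun v _ => ?_
    rcases (hπ0 v).eq_or_lt with h0 | h0
    · simp [← h0]
    · simp [hF₀π v h0]
  have hlag : ∀ F : Finset A, (∀ v, 0 ≤ slack h b F v) →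
      0 ≤ ∑ v, π v * (slack h b F v : ℝ) := fun F hF =>
    Finset.sum_nonneg fun v _ => mul_nonneg (hπ0 v) (by exact_mod_cast hF v)
  -- Complementary slackness: optimality amounts to minimizing the Lagrangian with slack in `[0,
  -- ∞)`, or in `{0}` where `π v > 0`.
  have hset : slack h b '' {F : Finset A | (M.IsBase (F : Set A) ∧ ∀ v, 0 ≤ slack h b F v) ∧
      ∀ G : Finset A, M.IsBase (G : Set A) → (∀ v, 0 ≤ slack h b G v) →
        ∑ a ∈ F, c a ≤ ∑ a ∈ G, c a}
      = {x ∈ slack h b '' lagrangianMinimizers M h b c π |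
          ∀ v, x v ∈ {n : ℤ | 0 ≤ n ∧ (0 < π v → n = 0)}} := by
    ext x
    constructor
    · rintro ⟨F, ⟨⟨hF, hFs⟩, hFopt⟩, rfl⟩
      have h1 := hFopt F₀ hF₀.1 hF₀s
      have h2 := hF₀.2 F hF
      have h3 := hlag F hFs
      have h4 : ∑ v, π v * (slack h b F v : ℝ) = 0 := by
        rw [hF₀lag] at h2
        unfold lagrangian at h2
        linarith
      refine ⟨⟨F, ⟨hF, fun G hG => ?_⟩, rfl⟩, fun v => ⟨hFs v, fun hv => ?_⟩⟩
      · refine le_trans ?_ (hF₀.2 G hG)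
        rw [hF₀lag, lagrangian, h4, sub_zero]
        exact h1
      · have h5 := (Finset.sum_eq_zero_iff_of_nonneg (fun v _ =>
          mul_nonneg (hπ0 v) (by exact_mod_cast hFs v))).1 h4 v (Finset.mem_univ v)
        rcases mul_eq_zero.1 h5 with h6 | h6
        · exact absurd h6 hv.ne'
        · exact_mod_cast h6
    · rintro ⟨⟨F, hF, rfl⟩, hx⟩
      refine ⟨F, ⟨⟨hF.1, fun v => (hx v).1⟩, fun G hG hGs => ?_⟩, rfl⟩
      have h1 := hF.2 G hG
      have h2 := hlag G hGs
      have h3 : ∑ v, π v * (slack h b F v : ℝ) = 0 := Finset.sum_eq_zero fun v _ => by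
        rcases (hπ0 v).eq_or_lt with h0 | h0
        · simp [← h0]
        · simp [(hx v).2 h0]
      unfold lagrangian at h1
      linarith
  rw [hset]
  refine (isMConvex_slack_lagrangianMinimizers M hE h b c π).inter_pi fun v => ⟨?_⟩
  rintro m ⟨hm, hm'⟩ n ⟨hn, hn'⟩ l ⟨hl, hl'⟩
  exact ⟨by omega, fun hv => by have := hm' hv; have := hn' hv; omega⟩

end Lagrangian

namespace ArcDigraph

/-! ### The matroid of sparse arc sets. -/

section Sparse

variable {V A : Type*} [DecidableEq V] (D : ArcDigraph V A)

/-- The arcs of `F` with both ends in `X`. -/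
def inner (F : Finset A) (X : Finset V) : Finset A :=
  F.filter fun a => D.tail a ∈ X ∧ D.head a ∈ X

theorem mem_inner {F : Finset A} {X : Finset V} {a : A} :
    a ∈ D.inner F X ↔ a ∈ F ∧ D.tail a ∈ X ∧ D.head a ∈ X := by
  simp [inner]

/-- Every nonempty node set `X` spans at most `k (|X| - 1)` arcs of `F`. -/
def IsSparse (k : ℕ) (F : Finset A) : Prop :=
  ∀ X : Finset V, X.Nonempty → (D.inner F X).card + k ≤ k * X.card

variable {D} {k : ℕ}

theorem IsSparse.mono {F G : Finset A} (hG : D.IsSparse k G) (h : F ⊆ G) : D.IsSparse k F :=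
  fun X hX => (Nat.add_le_add_right
    (Finset.card_le_card (Finset.filter_subset_filter _ h)) k).trans (hG X hX)

theorem card_inner_add_card_inner_le (F : Finset A) (X Y : Finset V) :
    (D.inner F X).card + (D.inner F Y).card
      ≤ (D.inner F (X ∩ Y)).card + (D.inner F (X ∪ Y)).card := by
  simp only [inner, Finset.card_filter, ← Finset.sum_add_distrib]
  refine Finset.sum_le_sum fun a _ => ?_
  simp only [Finset.mem_inter, Finset.mem_union]
  by_cases h1 : D.tail a ∈ X <;> by_cases h2 : D.head a ∈ X <;> by_cases h3 : D.tail a ∈ Y <;>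
    by_cases h4 : D.head a ∈ Y <;> simp [h1, h2, h3, h4]

theorem IsSparse.union_tight {F : Finset A} (hF : D.IsSparse k F) {X Y : Finset V}
    (hXY : (X ∩ Y).Nonempty) (hX : (D.inner F X).card + k = k * X.card)
    (hY : (D.inner F Y).card + k = k * Y.card) :
    (D.inner F (X ∪ Y)).card + k = k * (X ∪ Y).card := by
  have h1 := hF _ hXY
  have h2 := hF (X ∪ Y) (hXY.mono (Finset.inter_subset_left.trans Finset.subset_union_left))
  have h3 := card_inner_add_card_inner_le (D := D) F X Y
  have h4 : k * (X ∪ Y).card + k * (X ∩ Y).card = k * X.card + k * Y.card := by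
    rw [← mul_add, ← mul_add, Finset.card_union_add_card_inter]
  omega

variable [Fintype V]

/-- If no arc can be added, every arc of `J \ I` lies in a set tight for `I`. Maximal tight sets
partition the nodes because intersecting tight sets have tight union. Inside each class `I` has the
largest possible number of arcs, and every arc of `J` between classes is already in `I`; hence `|J|
≤ |I|`. -/
theorem IsSparse.exists_insert {I J : Finset A} [DecidableEq A] (hI : D.IsSparse k I)
    (hJ : D.IsSparse k J) (hlt : I.card < J.card) :
    ∃ e ∈ J, e ∉ I ∧ D.IsSparse k (insert e I) := by
  classical
  by_contra! hcon
  have htight : ∀ e ∈ J, e ∉ I → ∃ X : Finset V, (D.inner I X).card + k = k * X.card ∧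
      D.tail e ∈ X ∧ D.head e ∈ X := by
    intro e heJ heI
    have := hcon e heJ heI
    simp only [IsSparse, not_forall, not_le] at this
    obtain ⟨X, hX, hlt⟩ := this
    have h1 := hI X hX
    by_cases he : D.tail e ∈ X ∧ D.head e ∈ X
    · refine ⟨X, ?_, he⟩
      have : D.inner (insert e I) X = insert e (D.inner I X) := by
        simp only [inner, Finset.filter_insert, if_pos he]
      have h2 := Finset.card_insert_le e (D.inner I X)
      rw [this] at hlt
      omega
    · have : D.inner (insert e I) X = D.inner I X := by
        simp only [inner, Finset.filter_insert, if_neg he]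
      rw [this] at hlt
      omega
  have hmax : ∀ v : V, ∃ X : Finset V, v ∈ X ∧ (D.inner I X).card + k = k * X.card ∧
      ∀ Y : Finset V, v ∈ Y → (D.inner I Y).card + k = k * Y.card → Y ⊆ X := by
    intro v
    obtain ⟨X, hX, hXmax⟩ := Finset.exists_max_image
      (Finset.univ.filter fun X : Finset V => v ∈ X ∧ (D.inner I X).card + k = k * X.card)
      -- Singletons are always tight, so the maximal tight sets cover the nodes.
      Finset.card ⟨{v}, by
        have := hI {v} (Finset.singleton_nonempty v)
        rw [Finset.card_singleton] at this
        simp only [Finset.mem_filter, Finset.mem_univ, Finset.mem_singleton, true_and,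
          Finset.card_singleton]
        omega⟩
    simp only [Finset.mem_filter, Finset.mem_univ, true_and] at hX hXmax
    refine ⟨X, hX.1, hX.2, fun Y hvY hY => ?_⟩
    have h1 := hI.union_tight ⟨v, Finset.mem_inter.2 ⟨hX.1, hvY⟩⟩ hX.2 hY
    have h2 := hXmax (X ∪ Y) ⟨Finset.mem_union_left _ hX.1, h1⟩
    rw [Finset.eq_of_subset_of_card_le Finset.subset_union_left h2]
    exact Finset.subset_union_right
  choose C hvC hC hCmax using hmax
  have hCeq : ∀ u v, u ∈ C v → C u = C v := by
    intro u v hu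
    have h1 : C v ⊆ C u := hCmax u _ hu (hC v)
    exact (hCmax v _ (h1 (hvC v)) (hC u)).antisymm h1
  have hcount : ∀ F : Finset A, F.card
      = ∑ X ∈ Finset.univ.image C, (D.inner F X).card
        + (F.filter fun a => D.tail a ∉ C (D.head a)).card := by
    intro F
    rw [← Finset.card_filter_add_card_filter_not (s := F) (fun a => D.tail a ∈ C (D.head a))]
    congr 1
    rw [Finset.card_eq_sum_card_fiberwise (f := fun a => C (D.head a)) (t := Finset.univ.image C)
      (fun a _ => by simp)]
    refine Finset.sum_congr rfl fun X hX => congrArg Finset.card ?_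
    obtain ⟨v, -, rfl⟩ := Finset.mem_image.1 hX
    ext a
    simp only [Finset.mem_filter, mem_inner]
    constructor
    · rintro ⟨⟨haF, hat⟩, hah⟩
      exact ⟨haF, hah ▸ hat, hah ▸ hvC _⟩
    · rintro ⟨haF, hat, hah⟩
      rw [hCeq _ _ hah]
      exact ⟨⟨haF, hat⟩, rfl⟩
  refine hlt.not_ge ?_
  rw [hcount I, hcount J]
  refine Nat.add_le_add (Finset.sum_le_sum fun X hX => ?_) (Finset.card_le_card fun a ha => ?_)
  · obtain ⟨v, -, rfl⟩ := Finset.mem_image.1 hX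
    have h1 := hC v
    have h2 := hJ (C v) ⟨v, hvC v⟩
    omega
  · rw [Finset.mem_filter] at ha ⊢
    refine ⟨?_, ha.2⟩
    by_contra haI
    obtain ⟨X, hX, hat, hah⟩ := htight a ha.1 haI
    exact ha.2 (hCmax _ X hah hX hat)

variable [Fintype A]

variable (D k) in
/-- The matroid of sparse arc sets. -/
noncomputable def sparseMatroid : Matroid A :=
  (IndepMatroid.ofFinite (E := Set.univ) Set.finite_univ
    (fun I => D.IsSparse k I.toFinite.toFinset)
    (fun X hX => by
      have : 1 ≤ X.card := hX.card_pos
      simpa [inner] using Nat.mul_le_mul_left k this)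
    (fun I J hJ hIJ => hJ.mono (by simpa using hIJ))
    (fun I J hI hJ hlt => by
      classical
      rw [Set.ncard_eq_toFinset_card _ I.toFinite, Set.ncard_eq_toFinset_card _ J.toFinite] at hlt
      obtain ⟨e, heJ, heI, he⟩ := hI.exists_insert hJ hlt
      refine ⟨e, by simpa using heJ, by simpa using heI, ?_⟩
      convert he
      ext
      simp)
    (fun I _ => Set.subset_univ I)).matroid

theorem sparseMatroid_E : (D.sparseMatroid k).E = Set.univ := rfl

theorem sparseMatroid_indep {F : Finset A} :
    (D.sparseMatroid k).Indep (F : Set A) ↔ D.IsSparse k F := by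
  have : (D.sparseMatroid k).Indep (F : Set A)
      ↔ D.IsSparse k (F : Set A).toFinite.toFinset := Iff.rfl
  rw [this, Finset.finite_toSet_toFinset]

/-- The hypothesis `hex` says that the upper bound `k(|V|-1)` on the rank is attained. -/
theorem sparseMatroid_isBase_iff [Nonempty V]
    (hex : ∃ F : Finset A, D.IsSparse k F ∧ F.card + k = k * Fintype.card V) {F : Finset A} :
    (D.sparseMatroid k).IsBase (F : Set A) ↔
      D.IsSparse k F ∧ F.card + k = k * Fintype.card V := by
  have hle : ∀ G : Finset A, D.IsSparse k G → G.card + k ≤ k * Fintype.card V := fun G hG => by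
    simpa [inner] using hG Finset.univ Finset.univ_nonempty
  have hbase : ∀ G : Finset A, D.IsSparse k G → G.card + k = k * Fintype.card V →
      (D.sparseMatroid k).IsBase (G : Set A) := by
    intro G hG hGc
    rw [Matroid.isBase_iff_maximal_indep]
    refine ⟨sparseMatroid_indep.2 hG, fun J hJ hGJ => ?_⟩
    have hJ' : D.IsSparse k J.toFinite.toFinset := hJ
    have := hle _ hJ'
    have h2 : G ⊆ J.toFinite.toFinset := by
      intro a ha
      simpa using hGJ ha
    have h3 := Finset.eq_of_subset_of_card_le h2 (by omega)
    rw [h3]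
    simp
  refine ⟨fun hF => ⟨sparseMatroid_indep.1 hF.indep, ?_⟩, fun hF => hbase F hF.1 hF.2⟩
  obtain ⟨G, hG, hGc⟩ := hex
  have := hF.encard_eq_encard_of_isBase (hbase G hG hGc)
  rw [Set.encard_coe_eq_coe_finsetCard, Set.encard_coe_eq_coe_finsetCard, Nat.cast_inj] at this
  omega

end Sparse

end ArcDigraph

namespace ArcDigraph

/-! ### Counting arcs in arborescences and their disjoint unions. -/

section Arborescence

theorem _root_.SimpleGraph.IsAcyclic.card_edgeFinset_add_one_le {W : Type*} [Fintype W] [Nonempty W]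
    {G : SimpleGraph W} [Fintype G.edgeSet] (hG : G.IsAcyclic) :
    G.edgeFinset.card + 1 ≤ Fintype.card W := by
  classical
  obtain ⟨T, hGT, -, hT⟩ := SimpleGraph.connected_top.exists_isTree_le_of_le_of_isAcyclic
    (le_top : G ≤ ⊤) hG
  rw [← hT.card_edgeFinset]
  exact Nat.add_le_add_right (Finset.card_le_card (SimpleGraph.edgeFinset_mono hGT)) 1

variable {V A : Type*} [DecidableEq V] {D : ArcDigraph V A} {T F : Finset A} {k : ℕ}

theorem IsSpanningTree.isSparse (hT : D.IsSpanningTree T) : D.IsSparse 1 T := by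
  classical
  intro X hX
  set G := SimpleGraph.fromEdgeSet ((fun a => s(D.tail a, D.head a)) '' (T : Set A)) with hG
  have hac : (G.induce (X : Set V)).IsAcyclic := hT.isTree.isAcyclic.induce (X : Set V)
  have : Nonempty (X : Set V) := hX.to_subtype
  have h1 := hac.card_edgeFinset_add_one_le
  have h2 : (D.inner T X).card ≤ (G.induce (X : Set V)).edgeFinset.card := by
    rw [← Finset.card_image_of_injOn (f := fun a => s(D.tail a, D.head a)) (s := D.inner T X)
      (hT.noParallel.mono fun a ha => (D.mem_inner.1 ha).1)]
    refine le_trans (Finset.card_le_card ?_)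
      (Finset.card_image_le (s := (G.induce (X : Set V)).edgeFinset) (f := Sym2.map Subtype.val))
    intro e he
    obtain ⟨a, ha, rfl⟩ := Finset.mem_image.1 he
    obtain ⟨haT, hat, hah⟩ := D.mem_inner.1 ha
    refine Finset.mem_image.2 ⟨s(⟨D.tail a, hat⟩, ⟨D.head a, hah⟩), ?_, rfl⟩
    rw [SimpleGraph.mem_edgeFinset, SimpleGraph.mem_edgeSet, SimpleGraph.comap_adj]
    rw [hG]
    exact (SimpleGraph.fromEdgeSet_adj _).2 ⟨⟨a, haT, rfl⟩, hT.loopless a haT⟩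
  have h3 : Fintype.card (X : Set V) = X.card := by simp
  omega

theorem IsDecomposition.card_filter {T : Fin k → Finset A} (hT : D.IsDecomposition F T)
    (P : A → Prop) [DecidablePred P] :
    (F.filter P).card = ∑ i, ((T i).filter P).card := by
  classical
  rw [← Finset.card_biUnion fun i _ j _ hij =>
    Finset.disjoint_filter_filter (hT.disjoint i j hij)]
  congr 1
  ext a
  simp [hT.mem_iff, and_comm]

theorem IsDecomposition.isSparse {T : Fin k → Finset A} (hT : D.IsDecomposition F T) : D.IsSparse k F := by
  intro X hX
  have h1 : (D.inner F X).card = ∑ i, (D.inner (T i) X).card := hT.card_filter _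
  have h2 : ∑ i, ((D.inner (T i) X).card + 1) ≤ ∑ _i : Fin k, X.card :=
    Finset.sum_le_sum fun i _ => by
      simpa using (hT.isArborescence i).isSpanningTree.isSparse X hX
  simp only [Finset.sum_add_distrib, Finset.sum_const, Finset.card_univ, Fintype.card_fin,
    smul_eq_mul, mul_one] at h2
  omega

theorem IsDecomposition.inDegree_le {T : Fin k → Finset A} (hT : D.IsDecomposition F T) (v : V) :
    D.inDegree F v ≤ k := by
  have h1 : D.inDegree F v = ∑ i, D.inDegree (T i) v := hT.card_filter _
  rw [h1]
  simpa using Finset.sum_le_sum fun i (_ : i ∈ Finset.univ) =>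
    (hT.isArborescence i).inDegree_le_one v

variable [Fintype V]

theorem sum_inDegree (D : ArcDigraph V A) (F : Finset A) : ∑ v, D.inDegree F v = F.card :=
  (Finset.card_eq_sum_card_fiberwise (f := D.head) (t := Finset.univ)
    (fun _ _ => Finset.mem_coe.2 (Finset.mem_univ _))).symm

theorem IsSpanningTree.card_add_one (hT : D.IsSpanningTree T) : T.card + 1 = Fintype.card V := by
  classical
  rw [← hT.isTree.card_edgeFinset,
    ← Finset.card_image_of_injOn (f := fun a => s(D.tail a, D.head a)) hT.noParallel]
  congr 2
  ext e
  simp only [SimpleGraph.mem_edgeFinset, SimpleGraph.edgeSet_fromEdgeSet, Finset.mem_image]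
  constructor
  · rintro ⟨a, ha, rfl⟩
    exact ⟨⟨a, ha, rfl⟩, by simpa using hT.loopless a ha⟩
  · rintro ⟨⟨a, ha, rfl⟩, -⟩
    exact ⟨a, ha, rfl⟩

/-- Each term is at most 1, and the total is `|V|` because a tree has `|V| - 1` arcs; so every term
equals 1. -/
theorem IsArborescenceRootedAt.inDegree_eq {r : V} (hT : D.IsArborescenceRootedAt T r) (v : V) :
    D.inDegree T v + (if r = v then 1 else 0) = 1 := by
  have hcard := hT.isArborescence.isSpanningTree.card_add_one
  have hle : ∀ v ∈ Finset.univ, D.inDegree T v + (if r = v then 1 else 0) ≤ 1 := by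
    intro v _
    split_ifs with h
    · subst h; rw [hT.inDegree_root]
    · exact hT.isArborescence.inDegree_le_one v
  refine (Finset.sum_eq_sum_iff_of_le hle).1 ?_ v (Finset.mem_univ v)
  rw [Finset.sum_add_distrib, sum_inDegree]
  simpa using hcard

variable {T : Fin k → Finset A}

theorem IsDecomposition.card (hT : D.IsDecomposition F T) : F.card + k = k * Fintype.card V := by
  have h1 : F.card = ∑ i, (T i).card := by
    simpa using hT.card_filter fun _ => True
  have h2 : ∑ i, ((T i).card + 1) = ∑ _i : Fin k, Fintype.card V :=
    Finset.sum_congr rfl fun i _ => (hT.isArborescence i).isSpanningTree.card_add_one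
  simp only [Finset.sum_add_distrib, Finset.sum_const, Finset.card_univ, Fintype.card_fin,
    smul_eq_mul, mul_one] at h2
  omega

theorem IsDecomposition.inDegree_add_card (hT : D.IsDecomposition F T) {r : Fin k → V}
    (hr : ∀ i, D.IsArborescenceRootedAt (T i) (r i)) (v : V) :
    D.inDegree F v + (Finset.univ.filter fun i => r i = v).card = k := by
  have h1 : D.inDegree F v = ∑ i, D.inDegree (T i) v := hT.card_filter _
  rw [h1, Finset.card_filter, ← Finset.sum_add_distrib,
    Finset.sum_congr rfl fun i _ => (hr i).inDegree_eq v]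
  simp

end Arborescence

end ArcDigraph

namespace ArcDigraph

/-! ### Edmonds' disjoint arborescences theorem, by growing one tree at a time. -/

section Edmonds

variable {V A : Type*} [DecidableEq V] (D : ArcDigraph V A)

/-- The number of arcs of `F` entering `X`. -/
def entering (F : Finset A) (X : Finset V) : ℕ :=
  (F.filter fun a => D.head a ∈ X ∧ D.tail a ∉ X).card

theorem entering_inter_add_entering_union_le (F : Finset A) (X Y : Finset V) :
    D.entering F (X ∩ Y) + D.entering F (X ∪ Y) ≤ D.entering F X + D.entering F Y := by
  simp only [entering, Finset.card_filter, ← Finset.sum_add_distrib]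
  refine Finset.sum_le_sum fun a _ => ?_
  simp only [Finset.mem_inter, Finset.mem_union]
  by_cases h1 : D.tail a ∈ X <;> by_cases h2 : D.head a ∈ X <;> by_cases h3 : D.tail a ∈ Y <;>
    by_cases h4 : D.head a ∈ Y <;> simp [h1, h2, h3, h4]

/-- The arcs of `T` form an arborescence with root `r` on the node set `R`. -/
structure IsPartialArborescence (T : Finset A) (r : V) (R : Finset V) : Prop where
  root_mem : r ∈ R
  loopless : ∀ a ∈ T, D.tail a ≠ D.head a
  tail_mem : ∀ a ∈ T, D.tail a ∈ R
  head_mem : ∀ a ∈ T, D.head a ∈ R.erase r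
  head_injOn : Set.InjOn D.head (T : Set A)
  card_add_one : T.card + 1 = R.card
  reachable : ∀ v ∈ R,
    (SimpleGraph.fromEdgeSet ((fun a => s(D.tail a, D.head a)) '' (T : Set A))).Reachable r v

variable {D}

theorem IsPartialArborescence.insert_arc [DecidableEq A] {T : Finset A} {r : V} {R : Finset V}
    (h : D.IsPartialArborescence T r R) {a : A} (ht : D.tail a ∈ R) (hh : D.head a ∉ R) :
    D.IsPartialArborescence (insert a T) r (insert (D.head a) R) := by
  have haT : a ∉ T := fun haT => hh (Finset.mem_of_mem_erase (h.head_mem a haT))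
  have hne : D.tail a ≠ D.head a := fun he => hh (he ▸ ht)
  have hmono : SimpleGraph.fromEdgeSet ((fun a => s(D.tail a, D.head a)) '' (T : Set A))
      ≤ SimpleGraph.fromEdgeSet ((fun a => s(D.tail a, D.head a)) '' (insert a T : Finset A)) :=
    SimpleGraph.fromEdgeSet_mono (Set.image_mono (by simp))
  refine ⟨Finset.mem_insert_of_mem h.root_mem, ?_, ?_, ?_, ?_, ?_, ?_⟩
  · simpa [hne] using h.loopless
  · intro e he
    rcases Finset.mem_insert.1 he with rfl | he
    · exact Finset.mem_insert_of_mem ht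
    · exact Finset.mem_insert_of_mem (h.tail_mem e he)
  · intro e he
    rcases Finset.mem_insert.1 he with rfl | he
    · exact Finset.mem_erase.2 ⟨fun hr => hh (hr ▸ h.root_mem), Finset.mem_insert_self _ _⟩
    · have := Finset.mem_erase.1 (h.head_mem e he)
      exact Finset.mem_erase.2 ⟨this.1, Finset.mem_insert_of_mem this.2⟩
  · rw [Finset.coe_insert, Set.injOn_insert (by simpa using haT)]
    refine ⟨h.head_injOn, ?_⟩
    rintro ⟨e, he, heq⟩
    exact hh (heq ▸ Finset.mem_of_mem_erase (h.head_mem e he))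
  · rw [Finset.card_insert_of_notMem haT, Finset.card_insert_of_notMem hh, h.card_add_one]
  · intro v hv
    have key : ∀ v ∈ R, (SimpleGraph.fromEdgeSet
        ((fun a => s(D.tail a, D.head a)) '' (insert a T : Finset A))).Reachable r v :=
      fun v hv => (h.reachable v hv).mono hmono
    rcases Finset.mem_insert.1 hv with rfl | hv
    · refine (key _ ht).trans (SimpleGraph.Adj.reachable ?_)
      exact (SimpleGraph.fromEdgeSet_adj _).2 ⟨⟨a, by simp, rfl⟩, hne⟩
    · exact key v hv

variable [Fintype V]

/-- A connected graph needs at least `|V| - 1` edges, which is the number of arcs; so no two arcs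
are parallel and the graph is a tree. -/
theorem IsPartialArborescence.isArborescenceRootedAt {T : Finset A} {r : V}
    (h : D.IsPartialArborescence T r Finset.univ) : D.IsArborescenceRootedAt T r := by
  classical
  set G := SimpleGraph.fromEdgeSet ((fun a => s(D.tail a, D.head a)) '' (T : Set A)) with hG
  have hconn : G.Connected := by
    have : Nonempty V := ⟨r⟩
    refine ⟨fun u v => ?_⟩
    exact (h.reachable u (Finset.mem_univ u)).symm.trans (h.reachable v (Finset.mem_univ v))
  have hedge : G.edgeSet = (T.image fun a => s(D.tail a, D.head a) : Finset (Sym2 V)) := by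
    ext e
    rw [hG, SimpleGraph.edgeSet_fromEdgeSet, Finset.coe_image]
    constructor
    · exact fun h => h.1
    · rintro ⟨a, ha, rfl⟩
      exact ⟨⟨a, ha, rfl⟩, by simpa using h.loopless a ha⟩
  have hcardE : Nat.card G.edgeSet = (T.image fun a => s(D.tail a, D.head a)).card := by
    rw [hedge]
    simp
  have hV : T.card + 1 = Nat.card V := by
    rw [h.card_add_one, Finset.card_univ, Nat.card_eq_fintype_card]
  have h1 := hconn.card_vert_le_card_edgeSet_add_one
  have h2 : (T.image fun a => s(D.tail a, D.head a)).card ≤ T.card := Finset.card_image_le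
  have himg : (T.image fun a => s(D.tail a, D.head a)).card = T.card := by omega
  refine ⟨⟨⟨h.loopless, Finset.card_image_iff.1 himg,
    SimpleGraph.isTree_iff_connected_and_card.2 ⟨hconn, by rw [← hG]; omega⟩⟩, fun v => ?_⟩, ?_⟩
  · refine Finset.card_le_one.2 fun a ha e he => ?_
    rw [Finset.mem_filter] at ha he
    exact h.head_injOn ha.1 he.1 (ha.2.trans he.2.symm)
  · refine Finset.card_eq_zero.2 (Finset.filter_eq_empty_iff.2 fun a ha hr => ?_)
    exact (Finset.mem_erase.1 (h.head_mem a ha)).1 hr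

variable [DecidableEq A]

/-- One step of growing an arborescence whose removal keeps the remaining arcs well connected. -/
theorem exists_grow {F T : Finset A} {r : V} {R : Finset V} {k : ℕ} {q : V → ℕ}
    (hq : ∑ v, q v = k)
    (hF : ∀ X : Finset V, X.Nonempty →
      k + 1 ≤ D.entering F X + ∑ v ∈ X, q v + (if r ∈ X then 1 else 0))
    (hT : D.IsPartialArborescence T r R)
    (hFT : ∀ X : Finset V, X.Nonempty → k ≤ D.entering (F \ T) X + ∑ v ∈ X, q v)
    (hR : R ≠ Finset.univ) :
    ∃ a ∈ F \ T, D.tail a ∈ R ∧ D.head a ∉ R ∧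
      ∀ X : Finset V, X.Nonempty → k ≤ D.entering (F \ insert a T) X + ∑ v ∈ X, q v := by
  have hRne : (Finset.univ \ R).Nonempty := by
    rw [Finset.sdiff_nonempty]
    exact fun h => hR (Finset.univ_subset_iff.1 h)
  -- Take a smallest tight set not contained in `R`; the full node set is one, since nothing enters
  -- it and `q` sums to `k`.
  obtain ⟨X, hX, hXmin⟩ := Finset.exists_min_image
    (Finset.univ.filter fun X : Finset V =>
      (X \ R).Nonempty ∧ D.entering (F \ T) X + ∑ v ∈ X, q v = k) Finset.card
    ⟨Finset.univ, Finset.mem_filter.2 ⟨Finset.mem_univ _, hRne, by simp [entering, hq]⟩⟩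
  simp only [Finset.mem_filter, Finset.mem_univ, true_and] at hX hXmin
  obtain ⟨hXR, hXk⟩ := hX
  -- No arc of `T` enters `X \ R`, and this set misses `r`, so it has one unit more than tightness
  -- needs. Hence some remaining arc enters `X \ R` from `X ∩ R`; it is the arc to add.
  have hlt : D.entering (F \ T) X < D.entering (F \ T) (X \ R) := by
    have h1 := hF _ hXR
    have h2 : r ∉ X \ R := fun h => (Finset.mem_sdiff.1 h).2 hT.root_mem
    have h3 : D.entering (F \ T) (X \ R) = D.entering F (X \ R) := by
      unfold entering
      congr 1
      ext a
      simp only [Finset.mem_filter, Finset.mem_sdiff]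
      constructor
      · rintro ⟨⟨h, -⟩, h'⟩
        exact ⟨h, h'⟩
      · rintro ⟨h, h'⟩
        exact ⟨⟨h, fun haT => h'.1.2 (Finset.mem_of_mem_erase (hT.head_mem a haT))⟩, h'⟩
    have h4 : ∑ v ∈ X \ R, q v ≤ ∑ v ∈ X, q v := Finset.sum_le_sum_of_subset Finset.sdiff_subset
    rw [if_neg h2] at h1
    omega
  obtain ⟨a, ha, haX⟩ := Finset.exists_mem_notMem_of_card_lt_card hlt
  simp only [Finset.mem_filter, Finset.mem_sdiff, not_and, not_not] at ha haX
  obtain ⟨⟨haF, haT⟩, ⟨hhX, hhR⟩, htXR⟩ := ha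
  have htX : D.tail a ∈ X := haX ⟨haF, haT⟩ hhX
  have htR : D.tail a ∈ R := htXR htX
  refine ⟨a, Finset.mem_sdiff.2 ⟨haF, haT⟩, htR, hhR, fun Y hY => ?_⟩
  have hYk := hFT Y hY
  have hsplit : F \ insert a T = (F \ T).erase a := by
    ext e
    simp only [Finset.mem_sdiff, Finset.mem_insert, Finset.mem_erase]
    tauto
  have hge : D.entering (F \ T) Y ≤ D.entering ((F \ T).erase a) Y
      + if D.head a ∈ Y ∧ D.tail a ∉ Y then 1 else 0 := by
    unfold entering
    rw [Finset.filter_erase]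
    split_ifs with h
    · have := Finset.pred_card_le_card_erase
        (s := (F \ T).filter fun a => D.head a ∈ Y ∧ D.tail a ∉ Y) (a := a)
      omega
    · rw [Finset.erase_eq_of_notMem (by simp [h])]
      simp
  rw [hsplit]
  by_cases hent : D.head a ∈ Y ∧ D.tail a ∉ Y
  · rw [if_pos hent] at hge
    by_cases hYt : D.entering (F \ T) Y + ∑ v ∈ Y, q v = k
    -- Uncrossing makes `X ∩ Y` tight, and it still contains the head of `a` outside `R`. Minimality
    -- forces `X ⊆ Y`, but the tail of `a` lies in `X` and not in `Y`.
    · exfalso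
      have h1 := hFT (X ∩ Y) ⟨D.head a, Finset.mem_inter.2 ⟨hhX, hent.1⟩⟩
      have h2 := hFT (X ∪ Y) ⟨D.head a, Finset.mem_union_left _ hhX⟩
      have h3 := D.entering_inter_add_entering_union_le (F \ T) X Y
      have h4 := Finset.sum_union_inter (s₁ := X) (s₂ := Y) (f := q)
      have h5 := hXmin (X ∩ Y) ⟨⟨D.head a, Finset.mem_sdiff.2
        ⟨Finset.mem_inter.2 ⟨hhX, hent.1⟩, hhR⟩⟩, by omega⟩
      have h6 := Finset.eq_of_subset_of_card_le Finset.inter_subset_left h5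
      exact hent.2 (Finset.mem_inter.1 (h6.symm ▸ htX)).2
    · omega
  · rw [if_neg hent] at hge
    omega

/-- The vector `q` counts the roots still to be served once `r` is removed; the arcs left after
deleting `T` satisfy Edmonds' condition for `q`. -/
theorem exists_arborescence_sdiff {F : Finset A} {r : V} {k : ℕ} {q : V → ℕ}
    (hq : ∑ v, q v = k)
    (hF : ∀ X : Finset V, X.Nonempty →
      k + 1 ≤ D.entering F X + ∑ v ∈ X, q v + (if r ∈ X then 1 else 0)) :
    ∃ T ⊆ F, D.IsArborescenceRootedAt T r ∧
      ∀ X : Finset V, X.Nonempty → k ≤ D.entering (F \ T) X + ∑ v ∈ X, q v := by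
  have grow : ∀ (m : ℕ) (T : Finset A) (R : Finset V), T ⊆ F → D.IsPartialArborescence T r R →
      (∀ X : Finset V, X.Nonempty → k ≤ D.entering (F \ T) X + ∑ v ∈ X, q v) →
      (Finset.univ \ R).card = m →
      ∃ T ⊆ F, D.IsArborescenceRootedAt T r ∧
        ∀ X : Finset V, X.Nonempty → k ≤ D.entering (F \ T) X + ∑ v ∈ X, q v := by
    intro m
    induction m with
    | zero =>
      intro T R hTF hT hFT hm
      have : R = Finset.univ := by
        rw [Finset.card_eq_zero, Finset.sdiff_eq_empty_iff_subset] at hm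
        exact Finset.univ_subset_iff.1 hm
      subst this
      exact ⟨T, hTF, hT.isArborescenceRootedAt, hFT⟩
    | succ m ih =>
      intro T R hTF hT hFT hm
      obtain ⟨a, ha, hat, hah, hFa⟩ := exists_grow hq hF hT hFT (by rintro rfl; simp at hm)
      refine ih (insert a T) (insert (D.head a) R)
        (Finset.insert_subset (Finset.mem_sdiff.1 ha).1 hTF) (hT.insert_arc hat hah) hFa ?_
      rw [Finset.sdiff_insert, Finset.card_erase_of_mem (by simp [hah]), hm]
      rfl
  refine grow _ ∅ {r} (Finset.empty_subset _) ⟨by simp, by simp, by simp, by simp, by simp, by simp,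
    fun v hv => ?_⟩ (fun X hX => ?_) rfl
  · rw [Finset.mem_singleton.1 hv]
  · have := hF X hX
    rw [Finset.sdiff_empty]
    split_ifs at this <;> omega

/-- Edmonds' theorem on disjoint arborescences with prescribed roots. -/
theorem exists_disjoint_arborescences {k : ℕ} (r : Fin k → V) (F : Finset A)
    (hF : ∀ X : Finset V, X.Nonempty →
      k ≤ D.entering F X + ∑ v ∈ X, (Finset.univ.filter fun i => r i = v).card) :
    ∃ T : Fin k → Finset A, (∀ i, T i ⊆ F) ∧ (∀ i, D.IsArborescenceRootedAt (T i) (r i)) ∧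
      ∀ i j, i ≠ j → Disjoint (T i) (T j) := by
  induction k generalizing F with
  | zero => exact ⟨fun i => i.elim0, fun i => i.elim0, fun i => i.elim0, fun i => i.elim0⟩
  | succ k ih =>
    have hq : ∑ v, (Finset.univ.filter fun i : Fin k => r i.succ = v).card = k := by
      rw [← Finset.card_eq_sum_card_fiberwise (f := fun i : Fin k => r i.succ)
        (fun _ _ => Finset.mem_coe.2 (Finset.mem_univ _))]
      simp
    obtain ⟨T₀, hT₀F, hT₀, hFT⟩ := exists_arborescence_sdiff (D := D) (F := F) (r := r 0) hq
      (fun X hX => by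
        have := hF X hX
        simp only [Fin.card_filter_univ_succ] at this
        have hsum : ∑ v ∈ X, (if r 0 = v then
            (Finset.univ.filter fun i : Fin k => r i.succ = v).card + 1
            else (Finset.univ.filter fun i : Fin k => r i.succ = v).card)
            = ∑ v ∈ X, (Finset.univ.filter fun i : Fin k => r i.succ = v).card
              + if r 0 ∈ X then 1 else 0 := by
          rw [← Finset.sum_ite_eq X (r 0) (fun _ => 1), ← Finset.sum_add_distrib]
          refine Finset.sum_congr rfl fun v _ => ?_
          split_ifs <;> rfl
        have h2 := hsum ▸ this
        omega)
    obtain ⟨T, hTF, hT, hdisj⟩ := ih (fun i => r i.succ) (F \ T₀) hFT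
    have h0 : ∀ i, Disjoint T₀ (T i) := fun i =>
      Finset.disjoint_left.2 fun a ha ha' => (Finset.mem_sdiff.1 (hTF i ha')).2 ha
    refine ⟨Fin.cons T₀ T, fun i => ?_, fun i => ?_, fun i j hij => ?_⟩
    · cases i using Fin.cases with
      | zero => exact hT₀F
      | succ i => exact (hTF i).trans Finset.sdiff_subset
    · cases i using Fin.cases with
      | zero => exact hT₀
      | succ i => exact hT i
    · cases i using Fin.cases with
      | zero =>
        cases j using Fin.cases with
        | zero => exact absurd rfl hij
        | succ j => exact h0 j
      | succ i =>
        cases j using Fin.cases with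
        | zero => exact (h0 i).symm
        | succ j => exact hdisj i j fun h => hij (h ▸ rfl)

end Edmonds

end ArcDigraph

namespace ArcDigraph

/-! ### Characterization of `k`-arborescences and their root vectors. -/

section RootVectors

variable {V A : Type*} [DecidableEq V] {D : ArcDigraph V A} {k : ℕ} {F : Finset A}

theorem sum_inDegree_eq_card_inner_add_entering (X : Finset V) :
    ∑ v ∈ X, D.inDegree F v = (D.inner F X).card + D.entering F X := by
  have h1 : ∑ v ∈ X, D.inDegree F v = (F.filter fun a => D.head a ∈ X).card := by
    rw [Finset.card_eq_sum_card_fiberwise (f := D.head) (t := X)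
      (s := F.filter fun a => D.head a ∈ X)
      (fun a ha => (Finset.mem_filter.1 (Finset.mem_coe.1 ha)).2)]
    refine Finset.sum_congr rfl fun v hv => congrArg Finset.card ?_
    ext a
    simp only [Finset.mem_filter]
    constructor
    · rintro ⟨h, rfl⟩
      exact ⟨⟨h, hv⟩, rfl⟩
    · rintro ⟨⟨h, -⟩, h'⟩
      exact ⟨h, h'⟩
  rw [h1, ← Finset.card_filter_add_card_filter_not (fun a => D.tail a ∈ X), Finset.filter_filter,
    Finset.filter_filter]
  simp only [inner, entering, and_comm]

variable [Fintype V]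

/-- A sparse arc set of full size with in-degrees at most `k` decomposes into `k` arborescences. -/
theorem IsSparse.exists_decomposition (hF : D.IsSparse k F)
    (hcard : F.card + k = k * Fintype.card V) (hdeg : ∀ v, D.inDegree F v ≤ k) :
    ∃ (T : Fin k → Finset A) (r : Fin k → V), D.IsDecomposition F T ∧
      ∀ i, D.IsArborescenceRootedAt (T i) (r i) := by
  classical
  have hq : ∑ v, (k - D.inDegree F v) = k := by
    have h1 : ∑ v, ((k - D.inDegree F v) + D.inDegree F v) = ∑ _v : V, k :=
      Finset.sum_congr rfl fun v _ => Nat.sub_add_cancel (hdeg v)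
    rw [Finset.sum_add_distrib, sum_inDegree, Finset.sum_const, Finset.card_univ, smul_eq_mul,
      mul_comm] at h1
    omega
  -- List each node `v` as a root `k - inDegree v` times.
  let e : Fin k ≃ Σ v : V, Fin (k - D.inDegree F v) :=
    (Fintype.equivFinOfCardEq (by simpa using hq)).symm
  let r : Fin k → V := fun i => (e i).1
  have hr : ∀ v, (Finset.univ.filter fun i => r i = v).card = k - D.inDegree F v := by
    intro v
    rw [← Fintype.card_subtype, ← Fintype.card_fin (k - D.inDegree F v)]
    exact Fintype.card_congr ((e.subtypeEquiv (q := fun s => s.1 = v) fun i => Iff.rfl).trans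
      (Equiv.sigmaSubtype v))
  -- The in-degree sum over `X` counts the arcs inside `X` and those entering it, so sparsity is
  -- precisely Edmonds' cut condition for these roots.
  obtain ⟨T, hTF, hT, hdisj⟩ := exists_disjoint_arborescences (D := D) r F fun X hX => by
    have h1 := hF X hX
    have h2 := sum_inDegree_eq_card_inner_add_entering (D := D) (F := F) X
    have h3 : ∑ v ∈ X, ((k - D.inDegree F v) + D.inDegree F v) = ∑ _v ∈ X, k :=
      Finset.sum_congr rfl fun v _ => Nat.sub_add_cancel (hdeg v)
    rw [Finset.sum_add_distrib, Finset.sum_const, smul_eq_mul, mul_comm] at h3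
    simp only [hr]
    omega
  refine ⟨T, r, ⟨fun i => (hT i).isArborescence, hdisj, fun a => ?_⟩, hT⟩
  have hU : D.IsDecomposition (Finset.univ.biUnion T) T :=
    ⟨fun i => (hT i).isArborescence, hdisj, fun a => by simp⟩
  -- Both sides have `k(|V| - 1)` arcs.
  have hUF : Finset.univ.biUnion T = F :=
    Finset.eq_of_subset_of_card_le (Finset.biUnion_subset.2 fun i _ => hTF i)
      (by have := hU.card; omega)
  rw [← hU.mem_iff, hUF]

theorem isKArborescence_iff :
    D.IsKArborescence k F ↔
      (D.IsSparse k F ∧ F.card + k = k * Fintype.card V) ∧ ∀ v, D.inDegree F v ≤ k := by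
  constructor
  · rintro ⟨T, hT⟩
    exact ⟨⟨hT.isSparse, hT.card⟩, hT.inDegree_le⟩
  · rintro ⟨⟨hF, hcard⟩, hdeg⟩
    obtain ⟨T, -, hT, -⟩ := hF.exists_decomposition hcard hdeg
    exact ⟨T, hT⟩

/-- Each tree of a decomposition enters `v` exactly once unless it is rooted there. So the root
vector is independent of the decomposition. -/
theorem isRootVector_iff (hF : D.IsKArborescence k F) {q : V → ℝ} :
    D.IsRootVector k F q ↔ ∀ v, q v = (k : ℝ) - D.inDegree F v := by
  constructor
  · rintro ⟨T, r, hT, hr, hq⟩ v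
    have h : (D.inDegree F v : ℝ) + ((Finset.univ.filter fun i => r i = v).card : ℝ) = k := by
      exact_mod_cast hT.inDegree_add_card hr v
    rw [hq]
    linarith
  · intro hq
    obtain ⟨⟨hs, hcard⟩, hdeg⟩ := isKArborescence_iff.1 hF
    obtain ⟨T, r, hT, hr⟩ := hs.exists_decomposition hcard hdeg
    refine ⟨T, r, hT, hr, fun v => ?_⟩
    have h : (D.inDegree F v : ℝ) + ((Finset.univ.filter fun i => r i = v).card : ℝ) = k := by
      exact_mod_cast hT.inDegree_add_card hr v
    rw [hq]
    linarith

end RootVectors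

end ArcDigraph

/-! ### The main theorem. -/

theorem mainTheorem2 {V A : Type*} [Fintype V] [DecidableEq V] [Fintype A]
    (D : ArcDigraph V A) (c : A → ℝ) (k : ℕ) (hk : 0 < k)
    (hD : ∃ F : Finset A, D.IsKArborescence k F) :
    IsBasePolyhedron (convexHull ℝ (D.optimalRootVectors k c)) := by
  have hne : Nonempty V := by
    obtain ⟨F, T, hT⟩ := hD
    exact (hT.isArborescence ⟨0, hk⟩).isSpanningTree.isTree.connected.nonempty
  have hbase : ∀ {F : Finset A}, (D.sparseMatroid k).IsBase (F : Set A) ↔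
      D.IsSparse k F ∧ F.card + k = k * Fintype.card V := by
    obtain ⟨F₀, hF₀⟩ := hD
    exact ArcDigraph.sparseMatroid_isBase_iff ⟨F₀, (ArcDigraph.isKArborescence_iff.1 hF₀).1⟩
  -- With capacity `k` at every node, slack is at once the degree bound and the root vector.
  have hslack : ∀ F : Finset A, (∀ v, 0 ≤ slack D.head (fun _ => (k : ℤ)) F v) ↔
      ∀ v, D.inDegree F v ≤ k := fun F =>
    forall_congr' fun v => by simp [slack, ArcDigraph.inDegree]
  have hkarb : ∀ F : Finset A, D.IsKArborescence k F ↔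
      (D.sparseMatroid k).IsBase (F : Set A) ∧ ∀ v, 0 ≤ slack D.head (fun _ => (k : ℤ)) F v :=
    fun F => by rw [ArcDigraph.isKArborescence_iff, hbase, hslack]
  have hM := isMConvex_slack_optimal (D.sparseMatroid k) ArcDigraph.sparseMatroid_E D.head
    (fun _ => (k : ℤ)) c (by
      obtain ⟨F, hF⟩ := hD
      exact ⟨F, (hkarb F).1 hF⟩)
  have hset : {F : Finset A | ((D.sparseMatroid k).IsBase (F : Set A) ∧
      ∀ v, 0 ≤ slack D.head (fun _ => (k : ℤ)) F v) ∧
      ∀ G : Finset A, (D.sparseMatroid k).IsBase (G : Set A) →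
        (∀ v, 0 ≤ slack D.head (fun _ => (k : ℤ)) G v) → ∑ a ∈ F, c a ≤ ∑ a ∈ G, c a}
      = {F | D.IsOptimalKArborescence k c F} := by
    ext F
    simp only [Set.mem_ofPred_eq, ArcDigraph.IsOptimalKArborescence, hkarb, and_imp]
  rw [hset] at hM
  have hroot : D.optimalRootVectors k c = (fun (x : V → ℤ) (v : V) => (x v : ℝ)) ''
      (slack D.head (fun _ => (k : ℤ)) '' {F | D.IsOptimalKArborescence k c F}) := by
    rw [Set.image_image]
    ext q
    constructor
    · rintro ⟨F, hF, hq⟩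
      refine ⟨F, hF, funext fun v => ?_⟩
      rw [(ArcDigraph.isRootVector_iff hF.1).1 hq v]
      simp [slack, ArcDigraph.inDegree]
    · rintro ⟨F, hF, rfl⟩
      refine ⟨F, hF, (ArcDigraph.isRootVector_iff hF.1).2 fun v => ?_⟩
      simp [slack, ArcDigraph.inDegree]
  rw [hroot]
  refine hM.isBasePolyhedron_convexHull ?_ ((Set.toFinite _).image _)
  obtain ⟨F, hF, hmin⟩ := Set.exists_min_image {F : Finset A | D.IsKArborescence k F}
    (fun F => ∑ a ∈ F, c a) (Set.toFinite _) hD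
  exact ⟨_, F, ⟨hF, hmin⟩, rfl⟩
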